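/- Let $\mathbb S=\mathbb R\cup\{-\infty\}$ with its order topology, and let $f_0,f_1$ be nonzero polynomials with nonnegative real coefficients in variables $x=(x_1,\dots,x_m)$ and parameters $a=(a_1,\dots,a_k)$, so that $f=f_0/f_1$ is a subtraction-free rational function. The ultradiscretization of a nonnegative function $g$ is $$G(X,A)=\lim_{\epsilon\to0^+}\epsilon\log g\big(e^{X_1/\epsilon},\dots,e^{X_m/\epsilon},e^{A_1/\epsilon},\dots,e^{A_k/\epsilon}\big)\in[-\infty,\infty],\qquad X\in\mathbb S^m,\ A\in\mathbb S^k,$$ with $e^{-\infty}=0$, $\log 0=-\infty$, $\log\infty=\infty$. Let $K$ be the field of algebraic functions in $z$, that is, of series in $z$ with complex coefficients and rational exponents (Puiseux series) that are algebraic over $\mathbb C(z)$. Let $\nu:K\to\mathbb S$ be given by $\nu(a_0z^{q_0}+a_1z^{q_1}+\cdots)=-q_0$ for $q_0<q_1<\cdots$ and $a_0\ne0$, and $\nu(0)=-\infty$. Fix $A\in\mathbb Q^k$ and lift the parameters to $a_j=z^{-A_j}$, so that $f_0,f_1$ become polynomials in $x$ over $K$. Put $V(f_i)=\{(\nu(x_1),\dots,\nu(x_m))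 : x\in K^m,\ f_i(x)=0\}\subseteq\mathbb S^m$. For a function $G:\mathbb S^m\to[-\infty,\infty]$, say that $G$ is differentiable at $P\in\mathbb S^m$ if, for $v\in\mathbb R^m$ near $0$, $G(P+v)$ is finite, and $v\mapsto G(P+v)$ is differentiable at $v=0$ (where $-\infty+r=-\infty$). Let $D(G)$ be the set of points of $\mathbb S^m$ where $G$ is not differentiable. Then the ultradiscretizations $F_0,F_1,F$ of $f_0,f_1,f$ exist, and $F=F_0-F_1$ (where both $F_0$ and $F_1$ are $-\infty$, which means $0/0$, the value of $F$ is by convention $-\infty$, so that $F$ counts as non-differentiable there). Regarded as functions of $X\in\mathbb S^m$, for fixed $A\in\mathbb Q^k$, they have the following properties. 1. For $i=0,1$: $V(f_i)=D(F_i)\cap(\mathbb Q\cup\{-\infty\})^m$ and $\overline{V(f_i)}=D(F_i)$. If $m=1$, then $V(f_i)=D(F_i)$. That is, the valuations of the roots of the numerator and of the denominator are the points of non-differentiability of $F_0$ and $F_1$ respectively. 2. $D(F)\subseteq D(F_0)\cup D(F_1)$, and every point of $D(F_0)\cup D(F_1)$ outside $D(F_0)\cap D(F_1)$ lies in $D(F)$.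 In particular, $D(F)=D(F_0)\cup D(F_1)$ if $D(F_0)\cap D(F_1)=\emptyset$. 3. If $m=1$, a real number $p$ lies in $D(F)$ if and only if the numbers of roots $r$ of $f_0$ and of $f_1$ with $\nu(r)=p$, counted with multiplicity, are different. -/

import Mathlib

open Filter Topology
open scoped NNReal ENNReal

noncomputable section

/-- The max-plus numbers `ℝ ∪ {-∞}`; `⊥` is `-∞`, and `⊥ + r = ⊥`. -/
abbrev MaxPlus : Type := WithBot ℝ

/-- The order topology on `ℝ ∪ {-∞}`: a basis at `-∞` is given by the rays `[-∞, r)`. -/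
instance instTopologicalSpaceMaxPlus : TopologicalSpace MaxPlus := Preorder.topology MaxPlus

instance instOrderTopologyMaxPlus : OrderTopology MaxPlus := ⟨rfl⟩

/-! ### Ultradiscretization -/

/-- `e ^ (X / ε)`, with `e ^ (-∞) = 0`. -/
def expScaled (ε : ℝ) : MaxPlus → ℝ≥0∞
  | ⊥ => 0
  | (r : ℝ) => ENNReal.ofReal (Real.exp (r / ε))

/-- `F` is the ultradiscretization of the nonnegative function `f`:
`F (X) = lim_{ε → 0⁺} ε log f (e ^ (X / ε))` for all `X` with coordinates in `ℝ ∪ {-∞}`,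
where `log 0 = -∞` and `log ∞ = +∞`. -/
def IsUltradiscretization {σ : Type*} (f : (σ → ℝ≥0∞) → ℝ≥0∞)
    (F : (σ → MaxPlus) → EReal) : Prop :=
  ∀ X : σ → MaxPlus,
    Tendsto (fun ε : ℝ => (ε : EReal) * ENNReal.log (f fun i => expScaled ε (X i)))
      (𝓝[>] 0) (𝓝 (F X))

/-- The function defined by a subtraction-free polynomial, that is, a polynomial with
coefficients in the semiring of nonnegative reals. -/
def sfEval {σ : Type*} (f : MvPolynomial σ ℝ≥0) (x : σ → ℝ≥0∞) : ℝ≥0∞ :=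
  MvPolynomial.eval₂ ENNReal.ofNNRealHom x f

/-- Fix the parameters (the variables indexed by `κ`) at the rational values `A`. -/
def fixParams {ι κ : Type*} (F : (ι ⊕ κ → MaxPlus) → EReal) (A : κ → ℚ) :
    (ι → MaxPlus) → EReal :=
  fun X => F (Sum.elim X fun j => (((A j : ℚ) : ℝ) : MaxPlus))

/-- Differentiability of `G` at a point `P` of `(ℝ ∪ {-∞})^ι`: `G` is finite at the points `P + v`
for small real `v`, and `v ↦ G (P + v)` is differentiable at `0`. If all coordinates of `P` are
real, this is ordinary differentiability; a coordinate of `P` equal to `-∞` stays `-∞` in `P + v`,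
so that in general only the real coordinates vary. -/
def TropDifferentiableAt {ι : Type*} [Fintype ι] (G : (ι → MaxPlus) → EReal)
    (P : ι → MaxPlus) : Prop :=
  (∀ᶠ v : ι → ℝ in 𝓝 0, G (fun i => P i + (v i : MaxPlus)) ≠ ⊥ ∧
      G (fun i => P i + (v i : MaxPlus)) ≠ ⊤) ∧
    DifferentiableAt ℝ (fun v : ι → ℝ => (G fun i => P i + (v i : MaxPlus)).toReal) 0

/-- The set of points of `(ℝ ∪ {-∞})^ι` at which `G` is not differentiable. -/
def nonDiffLocus {ι : Type*} [Fintype ι] (G : (ι → MaxPlus) → EReal) : Set (ι → MaxPlus) :=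
  {P | ¬ TropDifferentiableAt G P}

/-- The points all of whose coordinates are rational or `-∞`. -/
def rationalPoints (ι : Type*) : Set (ι → MaxPlus) :=
  {P | ∀ i, P i = ⊥ ∨ ∃ q : ℚ, P i = ((q : ℝ) : MaxPlus)}

/-! ### Algebraic functions and their valuation -/

/-- The field `ℂ(z)` of rational functions, inside the series in `z` with rational exponents. -/
abbrev RatFuncZ : IntermediateField ℂ (HahnSeries ℚ ℂ) :=
  IntermediateField.adjoin ℂ {HahnSeries.single (1 : ℚ) (1 : ℂ)}

/-- The field of algebraic functions in `z`: the series in `z` with complex coefficients and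
rational exponents that are algebraic over `ℂ(z)`. (Such series are Puiseux series.) -/
abbrev AlgFun : IntermediateField RatFuncZ (HahnSeries ℚ ℂ) :=
  algebraicClosure RatFuncZ (HahnSeries ℚ ℂ)

/-- `ν (a₀ z ^ q₀ + a₁ z ^ q₁ + ⋯) = -q₀` for `q₀ < q₁ < ⋯` and `a₀ ≠ 0`, and `ν 0 = -∞`. -/
def nu (x : AlgFun) : MaxPlus :=
  open scoped Classical in
  if x = 0 then ⊥ else ((-((x : HahnSeries ℚ ℂ).order : ℝ) : ℝ) : MaxPlus)

theorem single_mem_algFun (q : ℚ) : HahnSeries.single q (1 : ℂ) ∈ AlgFun := by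
  rw [mem_algebraicClosure_iff]
  have hz : HahnSeries.single (1 : ℚ) (1 : ℂ) ∈ RatFuncZ :=
    IntermediateField.mem_adjoin_simple_self ℂ _
  have hint : ∀ n : ℤ, HahnSeries.single (n : ℚ) (1 : ℂ) ∈ RatFuncZ := by
    have hnat : ∀ n : ℕ, HahnSeries.single (n : ℚ) (1 : ℂ) ∈ RatFuncZ := by
      intro n
      have h := pow_mem hz n
      rwa [HahnSeries.single_pow, one_pow, nsmul_one] at h
    intro n
    obtain ⟨m, rfl | rfl⟩ := n.eq_nat_or_neg
    · simpa using hnat m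
    · have h := inv_mem (hnat m)
      rw [HahnSeries.inv_single, inv_one] at h
      simpa using h
  refine IsAlgebraic.of_pow q.pos ?_
  rw [HahnSeries.single_pow, one_pow, nsmul_eq_mul, Rat.den_mul_eq_num]
  exact isAlgebraic_algebraMap (⟨_, hint q.num⟩ : RatFuncZ)

/-- The algebraic function `z ^ q`, for rational `q`. -/
def zPow (q : ℚ) : AlgFun := ⟨HahnSeries.single q 1, single_mem_algFun q⟩

/-- Nonnegative reals as constant algebraic functions. -/
def constAlgFun : ℝ≥0 →+* AlgFun :=
  (algebraMap ℂ AlgFun).comp (Complex.ofRealHom.comp NNReal.toRealHom)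

/-- The polynomial `f` at the point `x`, lifted to algebraic functions: the parameters `a_j`
(indexed by `κ`) are replaced by `z ^ (-A_j)`, so that `ν (a_j) = A_j`. -/
def liftEval {ι κ : Type*} (f : MvPolynomial (ι ⊕ κ) ℝ≥0) (A : κ → ℚ) (x : ι → AlgFun) : AlgFun :=
  MvPolynomial.eval₂ constAlgFun (Sum.elim x fun j => zPow (-A j)) f

/-- The image under `ν` of the roots of `f`. -/
def rootValuations {ι κ : Type*} (f : MvPolynomial (ι ⊕ κ) ℝ≥0) (A : κ → ℚ) :
    Set (ι → MaxPlus) :=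
  {P | ∃ x : ι → AlgFun, liftEval f A x = 0 ∧ P = fun i => nu (x i)}

/-- The lift of `f` as a polynomial in one variable, all variables indexed by `ι` being replaced
by this variable (used when `ι` has a single element). -/
def liftPoly {ι κ : Type*} (f : MvPolynomial (ι ⊕ κ) ℝ≥0) (A : κ → ℚ) : Polynomial AlgFun :=
  MvPolynomial.eval₂ (Polynomial.C.comp constAlgFun)
    (Sum.elim (fun _ => Polynomial.X) fun j => Polynomial.C (zPow (-A j))) f

/-- In one variable: the number of roots of `f`, with multiplicity, whose valuation is `p`. -/
def rootCount {ι κ : Type*} (f : MvPolynomial (ι ⊕ κ) ℝ≥0) (A : κ → ℚ) (p : MaxPlus) : ℕ :=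
  open scoped Classical in
  ((liftPoly f A).roots.filter fun r => nu r = p).card

end

/-! Polynomials with nonnegative coefficients do not cancel. Up to constant factors independent of
`ε`, the value of `fᵢ` at `e^(X/ε)` is therefore that of its largest monomial. So `Fᵢ` is the
tropical polynomial `tropEval`, the maximum of the monomial weights, and `F = F₀ - F₁`. Such a
maximum fails to be differentiable exactly where it is `-∞` or where two maximal monomials have
different exponents in `x` (`mem_nonDiffLocus_iff`).

The description of the root valuations is Kapranov's theorem. At a root the terms of maximal
valuation must cancel. Terms with the same exponents in `x` cannot cancel among themselves, since
the coefficients and lifted parameters are nonnegative, so two different exponents occur.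
Conversely, at a rational point with such a tie, lift the coordinates to powers of `z` and solve for
one in which the exponents differ. The field `K` is algebraically closed by the Newton–Puiseux
theorem, so the resulting polynomial in one variable splits. Multiplicativity of the Gauss norm then
writes the tropical polynomial along this coordinate as a constant plus the sum of `max p (ν r)`
over the roots `r` (`tropEval_update_eq`), so its corners are valuations of roots. The same formula
shows that the slope jumps at `p` by the number of roots of valuation `p`, which gives the criterion
for `D(F)` in one variable.

For the closure, the locus is closed, and its rational points are dense in it: real coordinates are
made rational by `ℚ`-linear maps that fix `1`, tend to the identity and preserve ties
(`exists_ratLinear_tendsto`). The inclusions for `D(F)` only use that sums and differences of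
differentiable functions are differentiable. -/

/-! ### The Newton–Puiseux theorem for monic polynomials over power series -/

section Puiseux

open Polynomial

namespace Polynomial

/-- The substitution `x = s y` of Newton's method: the divisibility lets `s ^ n` be taken out of `f
(s y)` coefficient by coefficient. -/
theorem Monic.exists_scaleRoots_eq {R : Type*} [CommRing R] [Nontrivial R] {f : R[X]}
    (hf : f.Monic) {s : R} (h : ∀ i < f.natDegree, s ^ (f.natDegree - i) ∣ f.coeff i) :
    ∃ g : R[X], g.Monic ∧ g.natDegree = f.natDegree ∧ g.scaleRoots s = f := by
  have h' : ∀ i, ∃ b, i ≤ f.natDegree → f.coeff i = s ^ (f.natDegree - i) * b := by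
    intro i
    rcases lt_trichotomy i f.natDegree with hi | rfl | hi
    · obtain ⟨b, hb⟩ := h i hi
      exact ⟨b, fun _ => hb⟩
    · exact ⟨1, fun _ => by simp [hf.leadingCoeff]⟩
    · exact ⟨0, fun h => absurd h (by omega)⟩
  choose b hb using h'
  set g : R[X] := ∑ i ∈ Finset.range (f.natDegree + 1), monomial i (b i) with hg
  have hcoeff : ∀ i, g.coeff i = if i ≤ f.natDegree then b i else 0 := by
    intro i
    simp [hg, coeff_monomial]
  have hbn : b f.natDegree = 1 := by
    have := hb f.natDegree le_rfl
    simpa [hf.leadingCoeff] using this.symm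
  have hdeg : g.natDegree = f.natDegree := by
    refine natDegree_eq_of_le_of_coeff_ne_zero (natDegree_le_iff_coeff_eq_zero.2 ?_) ?_
    · intro i hi
      rw [hcoeff, if_neg (by omega)]
    · rw [hcoeff, if_pos le_rfl, hbn]
      exact one_ne_zero
  refine ⟨g, ?_, hdeg, ?_⟩
  · change g.coeff g.natDegree = 1
    rw [hdeg, hcoeff, if_pos le_rfl, hbn]
  · ext i
    rw [coeff_scaleRoots, hdeg, hcoeff]
    split_ifs with hi
    · rw [hb i hi, mul_comm]
    · rw [zero_mul, coeff_eq_zero_of_natDegree_lt (by omega)]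

theorem Monic.coeff_comp_X_add_C_pred {R : Type*} [CommRing R] [Nontrivial R] {f : R[X]}
    (hf : f.Monic) (hn : f.natDegree ≠ 0) (r : R) :
    (f.comp (X + C r)).coeff (f.natDegree - 1) =
      f.coeff (f.natDegree - 1) + f.natDegree * r := by
  obtain ⟨n, hn'⟩ := Nat.exists_eq_succ_of_ne_zero hn
  rw [← taylor_apply, taylor_coeff, hn', Nat.succ_eq_add_one, Nat.add_sub_cancel,
    eval_eq_sum_range' (n := 2)]
  · have : f.coeff (n + 1) = 1 := by rw [← Nat.succ_eq_add_one, ← hn']; exact hf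
    simp [Finset.sum_range_succ, hasseDeriv_coeff, this, add_comm 1 n]
  · have := natDegree_hasseDeriv_le f n
    omega

end Polynomial

namespace PowerSeries

variable {k : Type*} [Field k]

instance isAdicComplete_maximalIdeal :
    IsAdicComplete (IsLocalRing.maximalIdeal k⟦X⟧) k⟦X⟧ := by
  rw [maximalIdeal_eq_span_X]
  infer_instance

theorem residue_eq_zero_iff {a : k⟦X⟧} :
    IsLocalRing.residue k⟦X⟧ a = 0 ↔ constantCoeff a = 0 := by
  rw [IsLocalRing.residue_eq_zero_iff, maximalIdeal_eq_span_X, Ideal.mem_span_singleton, X_dvd_iff]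

/-- A Hensel-type factorization from Weierstrass preparation. The reduction of `f` vanishes at `0`
to an order that is positive but less than the degree; this order is the degree of the distinguished
factor `g`. -/
theorem exists_monic_mul_eq_of_constantCoeff {f : k⟦X⟧[X]} (hf : f.Monic)
    (h0 : constantCoeff (f.coeff 0) = 0) {i : ℕ} (hi : i < f.natDegree)
    (h : constantCoeff (f.coeff i) ≠ 0) :
    ∃ g q : k⟦X⟧[X], g.Monic ∧ q.Monic ∧ f = g * q ∧
      g.natDegree < f.natDegree ∧ q.natDegree < f.natDegree := by
  have hres : (f : k⟦X⟧⟦X⟧).map (IsLocalRing.residue k⟦X⟧) ≠ 0 := by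
    intro h'
    have := congr_arg (coeff i) h'
    rw [coeff_map, Polynomial.coeff_coe, map_zero, residue_eq_zero_iff] at this
    exact h this
  obtain ⟨g, u, H⟩ := exists_isWeierstrassFactorization hres
  have hg := H.isDistinguishedAt.monic
  have hdeg := H.natDegree_eq_toNat_order_map
  have horder : ((f : k⟦X⟧⟦X⟧).map (IsLocalRing.residue k⟦X⟧)).order ≤ i := by
    refine order_le _ ?_
    rw [coeff_map, Polynomial.coeff_coe, Ne, residue_eq_zero_iff]
    exact h
  have hlt : g.natDegree < f.natDegree := by
    rw [hdeg]
    exact (ENat.toNat_le_of_le_natCast horder).trans_lt hi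
  have hpos : 0 < g.natDegree := by
    rw [hdeg, Nat.pos_iff_ne_zero, Ne, ENat.toNat_eq_zero, not_or]
    refine ⟨fun h' => ?_, order_finite_iff_ne_zero.2 hres |>.ne⟩
    have := (order_eq_nat (n := 0)).1 h'
    rw [coeff_map, Polynomial.coeff_coe, Ne, residue_eq_zero_iff] at this
    exact this.1 h0
  have hg_order : g.natDegree =
      ((g : k⟦X⟧⟦X⟧).map (IsLocalRing.residue k⟦X⟧)).order.toNat := by
    have := H.isDistinguishedAt.coe_natDegree_eq_order_map (g : k⟦X⟧⟦X⟧) 1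
      (by rw [constantCoeff_one, ← Ideal.ne_top_iff_one]; exact Ideal.IsMaximal.ne_top inferInstance)
      (by simp)
    exact congr_arg ENat.toNat (a₁ := (g.natDegree : ℕ∞)) this
  have hdiv := modByMonic_add_div f g
  -- Polynomial division by `g` and the identity `f = g * u` are both Weierstrass divisions of `f`
  -- by `g`. By uniqueness the remainder is `0`, so the cofactor is a polynomial.
  have hmod : f %ₘ g = 0 := by
    refine ((H.isDistinguishedAt.isWeierstrassDivisorAt'.eq_of_mul_add_eq_mul_add
      (q := ((f /ₘ g : k⟦X⟧[X]) : k⟦X⟧⟦X⟧)) (q' := u) (r' := 0) ?_ ?_ ?_).2)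
    · refine (degree_modByMonic_lt f hg).trans_le ?_
      rw [degree_eq_natDegree hg.ne_zero]
      exact_mod_cast hg_order.le
    · rw [Polynomial.degree_zero]
      exact WithBot.bot_lt_coe _
    · rw [Polynomial.coe_zero, add_zero, ← H.eq_mul, ← Polynomial.coe_mul, ← Polynomial.coe_add,
        add_comm, hdiv]
  rw [hmod, zero_add] at hdiv
  have hq : (f /ₘ g).Monic := hg.of_mul_monic_left (hdiv.symm ▸ hf)
  refine ⟨g, f /ₘ g, hg, hq, hdiv.symm, hlt, ?_⟩
  have := hg.natDegree_mul hq
  rw [hdiv] at this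
  omega

end PowerSeries

/-- Substitution of `z ^ (1 / M)` into a power series. -/
noncomputable def puiseuxHom (k : Type*) [Field k] (M : ℕ+) :
    PowerSeries k →+* HahnSeries ℚ k :=
  (HahnSeries.embDomainRingHom
    ((AddMonoidHom.mulRight ((M : ℚ)⁻¹)).comp (Nat.castAddMonoidHom ℚ))
    (fun a b h => by simpa using h)
    (fun a b => by
      have : (0 : ℚ) < (M : ℚ)⁻¹ := by simp
      simp [mul_le_mul_iff_left₀ this])).comp
    (HahnSeries.toPowerSeries.symm : PowerSeries k ≃+* HahnSeries ℕ k).toRingHom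

theorem coeff_puiseuxHom {k : Type*} [Field k] (M : ℕ+) (a : PowerSeries k) (n : ℕ) :
    (puiseuxHom k M a).coeff (n * (M : ℚ)⁻¹) = PowerSeries.coeff n a := by
  rw [← HahnSeries.coeff_toPowerSeries_symm]
  exact HahnSeries.embDomain_coeff (a := n)

theorem coeff_puiseuxHom_of_forall_ne {k : Type*} [Field k] (M : ℕ+) (a : PowerSeries k) {q : ℚ}
    (h : ∀ n : ℕ, (n : ℚ) * (M : ℚ)⁻¹ ≠ q) : (puiseuxHom k M a).coeff q = 0 :=
  HahnSeries.embDomain_of_notMem_range (by rintro ⟨n, hn⟩; exact h n hn)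

/-- This allows ramification `z ↦ z ^ p` inside Newton's method without changing the resulting
Puiseux series. -/
theorem puiseuxHom_expand {k : Type*} [Field k] (M p : ℕ+) (a : PowerSeries k) :
    puiseuxHom k (M * p) (a.expand p p.ne_zero) = puiseuxHom k M a := by
  ext q
  have hM : (M : ℚ) ≠ 0 := by simp
  have hp : (p : ℚ) ≠ 0 := by simp
  by_cases h : ∃ n : ℕ, (n : ℚ) * (M : ℚ)⁻¹ = q
  · obtain ⟨n, rfl⟩ := h
    rw [coeff_puiseuxHom]
    have : (n : ℚ) * (M : ℚ)⁻¹ = ((p * n : ℕ) : ℚ) * ((M * p : ℕ+) : ℚ)⁻¹ := by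
      push_cast
      field_simp
    rw [this, coeff_puiseuxHom, PowerSeries.coeff_expand_mul]
  · push Not at h
    rw [coeff_puiseuxHom_of_forall_ne _ _ h]
    by_cases h' : ∃ n : ℕ, (n : ℚ) * ((M * p : ℕ+) : ℚ)⁻¹ = q
    · obtain ⟨n, rfl⟩ := h'
      rw [coeff_puiseuxHom, PowerSeries.coeff_expand_of_not_dvd]
      rintro ⟨m, rfl⟩
      refine h m ?_
      push_cast
      field_simp
    · push Not at h'
      rw [coeff_puiseuxHom_of_forall_ne _ _ h']

variable {k : Type*} [Field k]

theorem splits_map_of_splits_map_comp_X_add_C {R K : Type*} [CommRing R] [Field K] (φ : R →+* K)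
    {f : R[X]} (r : R) (h : ((f.comp (X + C r)).map φ).Splits) : (f.map φ).Splits := by
  have h2 := h.comp_X_sub_C (φ r)
  rw [Polynomial.map_comp, comp_assoc] at h2
  simpa using h2

/-- Modulo `z`, translate a root `c` to `0`. If all lower coefficients then vanished, the reduction
of `f` would be `(x - c) ^ n`; its next coefficient `-n c` is `0`, so `c = 0` in characteristic
zero, against the hypothesis on coefficient `i`. Hence the translate factors properly and `IH`
applies. -/
theorem splits_map_puiseuxHom_of_constantCoeff_ne_zero [IsAlgClosed k] [CharZero k]
    {f : (PowerSeries k)[X]} (hf : f.Monic)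
    (IH : ∀ g : (PowerSeries k)[X], g.Monic → g.natDegree < f.natDegree →
      ∀ M, (g.map (puiseuxHom k M)).Splits)
    (hnext : f.coeff (f.natDegree - 1) = 0) {i : ℕ} (hi : i < f.natDegree)
    (h : PowerSeries.constantCoeff (f.coeff i) ≠ 0) (M : ℕ+) :
    (f.map (puiseuxHom k M)).Splits := by
  set φ : PowerSeries k →+* k := PowerSeries.constantCoeff
  obtain ⟨c, hc⟩ := IsAlgClosed.exists_root (f.map φ) (by
    rw [hf.degree_map, degree_eq_natDegree hf.ne_zero]
    exact_mod_cast (by omega : f.natDegree ≠ 0))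
  refine splits_map_of_splits_map_comp_X_add_C _ (PowerSeries.C c) ?_
  set g := f.comp (X + C (PowerSeries.C c)) with hg
  have hgm : g.Monic := hf.comp_X_add_C _
  have hgdeg : g.natDegree = f.natDegree := by simp [hg, natDegree_comp]
  have hgmap : g.map φ = (f.map φ).comp (X + C c) := by
    simp [hg, Polynomial.map_comp, φ]
  have hg0 : φ (g.coeff 0) = 0 := by
    rw [← coeff_map, hgmap, coeff_zero_eq_eval_zero, eval_comp]
    simpa using hc
  have hex : ∃ j < g.natDegree, φ (g.coeff j) ≠ 0 := by
    by_contra! hcon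
    have hpow : g.map φ = X ^ f.natDegree := by
      ext j
      rw [coeff_map, coeff_X_pow]
      rcases lt_trichotomy j g.natDegree with hj | hj | hj
      · rw [hcon j hj, if_neg (by omega)]
      · rw [if_pos (by omega), hj, hgm.coeff_natDegree, map_one]
      · rw [if_neg (by omega), coeff_eq_zero_of_natDegree_lt hj, map_zero]
    have hpow' : f.map φ = (X - C c) ^ f.natDegree := by
      have : f.map φ = ((f.map φ).comp (X + C c)).comp (X - C c) := by
        rw [comp_assoc]; simp
      rw [this, ← hgmap, hpow]
      simp
    have hn := congr_arg nextCoeff hpow'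
    rw [(monic_X_sub_C c).nextCoeff_pow, nextCoeff_X_sub_C, nextCoeff, hf.natDegree_map,
      if_neg (by omega), coeff_map, hnext, map_zero] at hn
    have hc0 : c = 0 := by
      have : (f.natDegree : k) ≠ 0 := by exact_mod_cast (by omega : f.natDegree ≠ 0)
      simpa [this] using hn.symm
    have := congr_arg (fun p => p.coeff i) hpow'
    simp only [coeff_map, hc0, map_zero, sub_zero, coeff_X_pow, if_neg hi.ne] at this
    exact h this
  obtain ⟨j, hj, hj'⟩ := hex
  obtain ⟨a, b, ha, hb, hab, hda, hdb⟩ :=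
    PowerSeries.exists_monic_mul_eq_of_constantCoeff hgm hg0 hj hj'
  rw [hab, Polynomial.map_mul]
  exact (IH a ha (hgdeg ▸ hda) M).mul (IH b hb (hgdeg ▸ hdb) M)

/-- The Newton polygon step. Choose `i₀` minimizing the slope `o i / (n - i)` and replace `z` by `z
^ (n - i₀)`. By minimality the roots can be divided by `z ^ o i₀` with coefficients remaining power
series, and coefficient `i₀` becomes a unit, which is the preceding case. -/
theorem splits_map_puiseuxHom_of_coeff_pred [IsAlgClosed k] [CharZero k]
    {f : (PowerSeries k)[X]} (hf : f.Monic)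
    (IH : ∀ g : (PowerSeries k)[X], g.Monic → g.natDegree < f.natDegree →
      ∀ M, (g.map (puiseuxHom k M)).Splits)
    (hnext : f.coeff (f.natDegree - 1) = 0) (M : ℕ+) :
    (f.map (puiseuxHom k M)).Splits := by
  set n := f.natDegree with hn'
  by_cases hpow : ∀ i < n, f.coeff i = 0
  · have : f = X ^ n := by
      ext1 j
      rw [coeff_X_pow]
      rcases lt_trichotomy j n with hj | hj | hj
      · rw [hpow j hj, if_neg (by omega)]
      · rw [if_pos (by omega), hj, hn', hf.coeff_natDegree]
      · rw [if_neg (by omega), coeff_eq_zero_of_natDegree_lt hj]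
    rw [this, Polynomial.map_pow, map_X]
    exact Splits.X_pow n
  push Not at hpow
  obtain ⟨i₁, hi₁, hi₁'⟩ := hpow
  classical
  -- A zero coefficient has order `⊤`, which `toNat` sends to `0`; such indices are filtered out
  -- below.
  set o : ℕ → ℕ := fun i => (f.coeff i).order.toNat
  obtain ⟨i₀, hi₀, hmin⟩ := Finset.exists_min_image
    ((Finset.range n).filter fun i => f.coeff i ≠ 0) (fun i => (o i : ℚ) / (n - i : ℕ))
    ⟨i₁, by simp [hi₁, hi₁']⟩
  rw [Finset.mem_filter, Finset.mem_range] at hi₀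
  have hmin' : ∀ i < n, f.coeff i ≠ 0 → o i₀ * (n - i) ≤ (n - i₀) * o i := by
    intro i hi hne
    have := hmin i (by simp [hi, hne])
    rw [div_le_div_iff₀ (by exact_mod_cast (by omega)) (by exact_mod_cast (by omega))] at this
    rw [mul_comm (n - i₀)]
    exact_mod_cast this
  set q : ℕ+ := ⟨n - i₀, by omega⟩ with hq
  have hqn : (q : ℕ) = n - i₀ := rfl
  set ε : PowerSeries k →+* PowerSeries k :=
    (PowerSeries.expand (R := k) (q : ℕ) q.ne_zero).toRingHom
  have hε : ∀ a, ε a = a.expand q q.ne_zero := fun a => rfl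
  have horder : ∀ a : PowerSeries k, (ε a).order = (q : ℕ) • a.order := fun a => by
    rw [hε, PowerSeries.order_expand]
  have hfε : (f.map ε).natDegree = n := hf.natDegree_map ε
  obtain ⟨g, hg, hgdeg, hgf⟩ := (hf.map ε).exists_scaleRoots_eq
    (s := (PowerSeries.X : PowerSeries k) ^ o i₀) (by
      intro i hi
      rw [hfε] at hi ⊢
      rw [coeff_map, ← pow_mul]
      by_cases hne : f.coeff i = 0
      · simp [hne]
      · refine (pow_dvd_pow _ (hmin' i hi hne)).trans ?_
        have h1 : (f.coeff i).order = (o i : ℕ∞) :=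
          (ENat.natCast_toNat (PowerSeries.order_finite_iff_ne_zero.2 hne).ne).symm
        refine PowerSeries.X_pow_dvd_iff.2 fun m hm => PowerSeries.coeff_of_lt_order m ?_
        rw [horder, h1, nsmul_eq_mul]
        exact_mod_cast hm)
  rw [hfε] at hgdeg
  have hcoeff : ∀ i, ε (f.coeff i) = g.coeff i * (PowerSeries.X ^ o i₀) ^ (n - i) := by
    intro i
    rw [← coeff_map, ← hgf, coeff_scaleRoots, hgdeg]
  have hmap : f.map (puiseuxHom k M) =
      (g.map (puiseuxHom k (M * q))).scaleRoots (puiseuxHom k (M * q) (PowerSeries.X ^ o i₀)) := by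
    rw [← map_scaleRoots _ _ _ (by simp [hg.leadingCoeff]), hgf, Polynomial.map_map]
    congr 1
    ext1 a
    exact (puiseuxHom_expand M q a).symm
  rw [hmap]
  refine Splits.scaleRoots ?_ _
  have hX : ∀ m, ((PowerSeries.X : PowerSeries k) ^ o i₀) ^ m ≠ 0 := fun m =>
    pow_ne_zero _ (pow_ne_zero _ PowerSeries.X_ne_zero)
  refine splits_map_puiseuxHom_of_constantCoeff_ne_zero hg ?_ ?_ (i := i₀) ?_ ?_ _
  · rwa [hgdeg]
  · have := hcoeff (n - 1)
    rw [hnext, map_zero] at this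
    rw [hgdeg]
    exact (mul_eq_zero.1 this.symm).resolve_right (hX _)
  · omega
  · intro h0
    obtain ⟨b, hb⟩ := PowerSeries.X_dvd_iff.2 h0
    have h2 : PowerSeries.X ^ (o i₀ * (n - i₀) + 1) ∣ ε (f.coeff i₀) := by
      refine ⟨b, ?_⟩
      rw [hcoeff, hb, pow_succ, pow_mul]
      ring
    have h1 : (f.coeff i₀).order = (o i₀ : ℕ∞) :=
      (ENat.natCast_toNat (PowerSeries.order_finite_iff_ne_zero.2 hi₀.2).ne).symm
    have h3 : (ε (f.coeff i₀)).order = ((o i₀ * (n - i₀) : ℕ) : ℕ∞) := by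
      rw [horder, h1, nsmul_eq_mul, hqn, mul_comm]
      push_cast
      rfl
    have h4 := (PowerSeries.order_eq_nat.1 h3).1
    exact h4 (PowerSeries.X_pow_dvd_iff.1 h2 _ (Nat.lt_succ_self _))

/-- **Newton–Puiseux theorem** for monic polynomials over the ring of power series. -/
theorem splits_map_puiseuxHom [IsAlgClosed k] [CharZero k] {f : (PowerSeries k)[X]}
    (hf : f.Monic) (M : ℕ+) : (f.map (puiseuxHom k M)).Splits := by
  induction hn : f.natDegree using Nat.strong_induction_on generalizing f M with
  | _ n IH =>
    by_cases hn0 : n = 0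
    · refine Splits.of_natDegree_le_one ?_
      rw [hf.natDegree_map]
      omega
    subst hn
    -- The Tschirnhaus translation: it kills the coefficient below the leading one, and needs `n`
    -- invertible.
    set r : PowerSeries k :=
      PowerSeries.C (-(f.natDegree : k)⁻¹) * f.coeff (f.natDegree - 1) with hr
    refine splits_map_of_splits_map_comp_X_add_C _ r ?_
    have hdeg : (f.comp (X + C r)).natDegree = f.natDegree := by simp [natDegree_comp]
    refine splits_map_puiseuxHom_of_coeff_pred (hf.comp_X_add_C _) ?_ ?_ M
    · intro g hg hlt M
      exact IH g.natDegree (by omega) hg M rfl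
    · rw [hdeg, hf.coeff_comp_X_add_C_pred hn0, hr]
      have : (f.natDegree : k) ≠ 0 := by exact_mod_cast hn0
      have h1 : (f.natDegree : PowerSeries k) = PowerSeries.C (f.natDegree : k) := by simp
      rw [h1, ← mul_assoc, ← map_mul, mul_neg, mul_inv_cancel₀ this]
      simp

end Puiseux

/-! ### Algebraic closedness of the field of algebraic functions -/

section AlgFunClosed

open Polynomial

theorem puiseuxHom_C {k : Type*} [Field k] (M : ℕ+) (c : k) :
    puiseuxHom k M (PowerSeries.C c) = HahnSeries.C c := by
  have h : (HahnSeries.toPowerSeries.symm (PowerSeries.C c) : HahnSeries ℕ k) =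
      HahnSeries.C c := by
    ext n
    rw [HahnSeries.coeff_toPowerSeries_symm, PowerSeries.coeff_C, HahnSeries.C_apply,
      HahnSeries.coeff_single]
    congr
  exact (congr_arg _ h).trans HahnSeries.embDomainRingHom_C

theorem puiseuxHom_one_X {k : Type*} [Field k] :
    puiseuxHom k 1 PowerSeries.X = HahnSeries.single 1 1 := by
  have h : (HahnSeries.toPowerSeries.symm (PowerSeries.X) : HahnSeries ℕ k) =
      HahnSeries.single 1 1 := by
    ext n
    rw [HahnSeries.coeff_toPowerSeries_symm, PowerSeries.coeff_X, HahnSeries.coeff_single]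
    congr
  change HahnSeries.embDomain _ (HahnSeries.toPowerSeries.symm PowerSeries.X) = _
  rw [h, HahnSeries.embDomain_single]
  congr 1
  simp

theorem exists_single_pow_mul_eq_puiseuxHom {x : HahnSeries ℚ ℂ} (hx : x ∈ RatFuncZ) :
    ∃ (n : ℕ) (a : PowerSeries ℂ), HahnSeries.single (1 : ℚ) (1 : ℂ) ^ n * x = puiseuxHom ℂ 1 a := by
  have hz : HahnSeries.single (1 : ℚ) (1 : ℂ) ≠ 0 := by simp
  induction hx using IntermediateField.adjoin_induction with
  | mem x hx =>
    rw [Set.mem_singleton_iff] at hx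
    exact ⟨0, PowerSeries.X, by rw [pow_zero, one_mul, hx, puiseuxHom_one_X]⟩
  | algebraMap c =>
    refine ⟨0, PowerSeries.C c, ?_⟩
    rw [pow_zero, one_mul, puiseuxHom_C, HahnSeries.algebraMap_apply', PowerSeries.algebraMap_apply,
      HahnSeries.ofPowerSeries_C]
    rfl
  | add x y _ _ hx hy =>
    obtain ⟨n, a, ha⟩ := hx
    obtain ⟨m, b, hb⟩ := hy
    refine ⟨n + m, PowerSeries.X ^ m * a + PowerSeries.X ^ n * b, ?_⟩
    rw [map_add, map_mul, map_mul, map_pow, map_pow, puiseuxHom_one_X, ← ha, ← hb]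
    ring
  | mul x y _ _ hx hy =>
    obtain ⟨n, a, ha⟩ := hx
    obtain ⟨m, b, hb⟩ := hy
    refine ⟨n + m, a * b, ?_⟩
    rw [map_mul, ← ha, ← hb]
    ring
  | inv x _ hx =>
    obtain ⟨n, a, ha⟩ := hx
    by_cases hx0 : x = 0
    · exact ⟨0, 0, by simp [hx0]⟩
    have ha0 : a ≠ 0 := by
      rintro rfl
      rw [map_zero, mul_eq_zero] at ha
      exact ha.elim (pow_ne_zero _ hz) hx0
    -- From `z ^ n * x = u * z ^ m` with `u` a unit it follows that `z ^ m * x⁻¹ = z ^ n * u⁻¹`.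
    obtain ⟨m, u, rfl⟩ :=
      IsDiscreteValuationRing.eq_unit_mul_pow_irreducible ha0 PowerSeries.X_irreducible
    refine ⟨m, PowerSeries.X ^ n * (↑u⁻¹ : PowerSeries ℂ), ?_⟩
    rw [map_mul, map_pow, puiseuxHom_one_X] at ha ⊢
    have hu : puiseuxHom ℂ 1 (u : PowerSeries ℂ) * puiseuxHom ℂ 1 (↑u⁻¹ : PowerSeries ℂ) = 1 := by
      rw [← map_mul, Units.mul_inv, map_one]
    have h : HahnSeries.single (1 : ℚ) (1 : ℂ) ^ m =
        HahnSeries.single (1 : ℚ) (1 : ℂ) ^ n * x * puiseuxHom ℂ 1 (↑u⁻¹ : PowerSeries ℂ) := by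
      rw [ha, mul_right_comm, hu, one_mul]
    rw [h]
    field_simp

theorem splits_map_hahnSeries_of_monic {p : RatFuncZ[X]} (hp : p.Monic) :
    (p.map (algebraMap RatFuncZ (HahnSeries ℚ ℂ))).Splits := by
  set z : HahnSeries ℚ ℂ := HahnSeries.single (1 : ℚ) (1 : ℂ) with hz
  have hz0 : z ≠ 0 := by simp [hz]
  set f := p.map (algebraMap RatFuncZ (HahnSeries ℚ ℂ)) with hf
  have hfm : f.Monic := hp.map _
  choose N a ha using fun i => exists_single_pow_mul_eq_puiseuxHom (p.coeff i).2
  set n := f.natDegree with hn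
  -- Scaling the roots by `z ^ s` clears all denominators, since `N i ≤ s ≤ s * (n - i)` for `i <
  -- n`. The scaling is undone at the end.
  set s := ∑ i ∈ Finset.range n, N i with hs
  set g : (PowerSeries ℂ)[X] := X ^ n +
    ∑ i ∈ Finset.range n,
      C (a i * PowerSeries.X ^ (s * (n - i) - N i)) * X ^ i with hg
  have hlt : (∑ i ∈ Finset.range n,
      C (a i * PowerSeries.X ^ (s * (n - i) - N i)) * X ^ i).degree < (n : WithBot ℕ) := by
    refine (degree_sum_le _ _).trans_lt ((Finset.sup_lt_iff (WithBot.bot_lt_coe n)).2 ?_)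
    intro i hi
    refine (degree_C_mul_X_pow_le _ _).trans_lt ?_
    exact Nat.cast_lt.2 (Finset.mem_range.1 hi)
  have hgm : g.Monic := monic_X_pow_add hlt
  have hgs : g.map (puiseuxHom ℂ 1) = f.scaleRoots (z ^ s) := by
    ext1 i
    rw [coeff_scaleRoots, ← hn, hg, coeff_map, coeff_add, coeff_X_pow, finsetSum_coeff]
    simp only [coeff_C_mul_X_pow]
    rcases lt_trichotomy i n with hi | hi | hi
    · rw [if_neg hi.ne, zero_add, Finset.sum_ite_eq, if_pos (Finset.mem_range.2 hi)]
      have hle : N i ≤ s * (n - i) :=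
        (Finset.single_le_sum (f := N) (fun _ _ => Nat.zero_le _) (Finset.mem_range.2 hi)).trans
          (Nat.le_mul_of_pos_right s (by omega))
      rw [map_mul, map_pow, puiseuxHom_one_X, ← ha, ← pow_mul]
      have h1 : f.coeff i = (p.coeff i : HahnSeries ℚ ℂ) := by rw [hf, coeff_map]; rfl
      rw [h1, ← hz, ← pow_mul_pow_sub z hle]
      ring
    · rw [if_pos hi, Finset.sum_ite_eq, if_neg (by simp [hi]), add_zero, map_one, hi, hn,
        hfm.coeff_natDegree]
      simp
    · rw [if_neg hi.ne', Finset.sum_ite_eq, if_neg (by simp [hi.le]), add_zero, map_zero,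
        coeff_eq_zero_of_natDegree_lt hi, zero_mul]
  have h1 := (hgs ▸ splits_map_puiseuxHom hgm 1).scaleRoots (z ^ s)⁻¹
  rwa [← scaleRoots_mul, mul_inv_cancel₀ (pow_ne_zero _ hz0), scaleRoots_one] at h1

/-- Roots in `E` of a polynomial over `F` are algebraic over `F`, so the splitting already takes
place in the algebraic closure of `F` in `E`. -/
theorem isAlgClosed_algebraicClosure_of_splits {F E : Type*} [Field F] [Field E] [Algebra F E]
    (h : ∀ p : F[X], p.Monic → (p.map (algebraMap F E)).Splits) :
    IsAlgClosed (algebraicClosure F E) := by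
  have : IsAlgClosure F (algebraicClosure F E) := by
    refine IsAlgClosure.of_splits fun p hp _ => ?_
    have hmap : (p.map (algebraMap F (algebraicClosure F E))).map
        (algebraMap (algebraicClosure F E) E) = p.map (algebraMap F E) := by
      rw [Polynomial.map_map, ← IsScalarTower.algebraMap_eq]
    refine Splits.of_splits_map (algebraMap (algebraicClosure F E) E) ?_ ?_
    · rw [hmap]
      exact h p hp
    · intro x hx
      rw [hmap, mem_roots', IsRoot, eval_map_algebraMap] at hx
      exact ⟨⟨x, mem_algebraicClosure_iff.2 ⟨p, hp.ne_zero, hx.2⟩⟩, rfl⟩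
  exact IsAlgClosure.isAlgClosed F

/-- The field of algebraic functions is algebraically closed. -/
instance isAlgClosed_algFun : IsAlgClosed AlgFun :=
  isAlgClosed_algebraicClosure_of_splits fun _ hp => splits_map_hahnSeries_of_monic hp

end AlgFunClosed

/-! ### Topology and arithmetic of the max-plus numbers -/

namespace MaxPlus

/-- The exponential `ℝ ∪ {-∞} → [0, ∞)`. -/
noncomputable def exp : MaxPlus → ℝ≥0 :=
  WithBot.recBotCoe 0 fun r => ⟨Real.exp r, (Real.exp_pos r).le⟩

@[simp] theorem exp_bot : exp ⊥ = 0 := rfl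

@[simp] theorem coe_exp_coe (r : ℝ) : (exp (r : MaxPlus) : ℝ) = Real.exp r := rfl

theorem exp_strictMono : StrictMono exp := by
  intro x y h
  induction y using WithBot.recBotCoe with
  | bot => exact absurd h not_lt_bot
  | coe y =>
    induction x using WithBot.recBotCoe with
    | bot => exact_mod_cast Real.exp_pos y
    | coe x => exact NNReal.coe_lt_coe.1 (Real.exp_lt_exp.2 (WithBot.coe_lt_coe.1 h))

theorem exp_surjective : Function.Surjective exp := by
  intro y
  rcases eq_or_ne y 0 with rfl | hy
  · exact ⟨⊥, rfl⟩
  · exact ⟨((Real.log y : ℝ) : MaxPlus),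
      NNReal.coe_injective (Real.exp_log (by exact_mod_cast pos_iff_ne_zero.2 hy))⟩

/-- The exponential as an order isomorphism. -/
noncomputable def expOrderIso : MaxPlus ≃o ℝ≥0 :=
  exp_strictMono.orderIsoOfSurjective exp exp_surjective

/-- Both sides carry the order topology. Continuity questions in `MaxPlus` thus move to `ℝ≥0`, where
addition becomes multiplication. -/
theorem isHomeomorph_exp : IsHomeomorph exp := expOrderIso.toHomeomorph.isHomeomorph

theorem exp_add (x y : MaxPlus) : exp (x + y) = exp x * exp y := by
  induction x using WithBot.recBotCoe with
  | bot => simp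
  | coe x =>
    induction y using WithBot.recBotCoe with
    | bot => simp
    | coe y => exact NNReal.coe_injective (Real.exp_add x y)

@[simp] theorem exp_zero : exp 0 = 1 := NNReal.coe_injective Real.exp_zero

theorem exp_nsmul (n : ℕ) (x : MaxPlus) : exp (n • x) = exp x ^ n := by
  induction n with
  | zero => simp
  | succ n ih => rw [succ_nsmul, exp_add, ih, pow_succ]

theorem exp_multiset_sum (m : Multiset MaxPlus) : exp m.sum = (m.map exp).prod := by
  induction m using Multiset.induction_on with
  | empty => simp
  | cons a m ih => rw [Multiset.sum_cons, exp_add, ih, Multiset.map_cons, Multiset.prod_cons]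

theorem continuous_add : Continuous fun x : MaxPlus × MaxPlus => x.1 + x.2 := by
  rw [isHomeomorph_exp.isInducing.continuous_iff]
  have : exp ∘ (fun x : MaxPlus × MaxPlus => x.1 + x.2) = fun x => exp x.1 * exp x.2 :=
    funext fun x => exp_add _ _
  rw [this]
  have h := isHomeomorph_exp.continuous
  fun_prop

instance : ContinuousAdd MaxPlus := ⟨continuous_add⟩

theorem continuous_coe : Continuous ((↑) : ℝ → MaxPlus) := by
  rw [isHomeomorph_exp.isInducing.continuous_iff]
  exact Real.continuous_exp.subtype_mk _

/-- The inclusion of `ℝ ∪ {-∞}` into `[-∞, ∞]`. -/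
noncomputable def toEReal : MaxPlus → EReal := WithBot.recBotCoe ⊥ fun r => (r : EReal)

@[simp] theorem toEReal_bot : toEReal ⊥ = ⊥ := rfl

@[simp] theorem toEReal_coe (r : ℝ) : toEReal (r : MaxPlus) = (r : EReal) := rfl

theorem nsmul_coe (n : ℕ) (r : ℝ) : n • (r : MaxPlus) = ((n * r : ℝ) : MaxPlus) := by
  rw [← nsmul_eq_mul]
  rfl

theorem nsmul_bot {n : ℕ} (hn : n ≠ 0) : n • (⊥ : MaxPlus) = ⊥ := by
  obtain ⟨m, rfl⟩ := Nat.exists_eq_succ_of_ne_zero hn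
  rw [succ_nsmul, WithBot.add_bot]

theorem coe_sum {α : Type*} (s : Finset α) (f : α → ℝ) :
    ((∑ a ∈ s, f a : ℝ) : MaxPlus) = ∑ a ∈ s, (f a : MaxPlus) := by
  classical
  induction s using Finset.induction_on with
  | empty => simp
  | insert a s ha ih => rw [Finset.sum_insert ha, Finset.sum_insert ha, WithBot.coe_add, ih]

theorem sum_eq_bot {α : Type*} {s : Finset α} {f : α → MaxPlus} {a : α} (ha : a ∈ s)
    (h : f a = ⊥) : ∑ a ∈ s, f a = ⊥ := by
  classical
  rw [← Finset.add_sum_erase s f ha, h, WithBot.bot_add]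

end MaxPlus

/-! ### Tropical polynomial functions -/

section TropEval

variable {σ : Type*} [Fintype σ]

/-- The weight of a monomial at a point of `(ℝ ∪ {-∞})^σ`. -/
noncomputable def tropWeight (Y : σ → MaxPlus) (s : σ →₀ ℕ) : MaxPlus := ∑ v, s v • Y v

/-- The tropical polynomial function of `f`, with trivially valued coefficients. -/
noncomputable def tropEval (f : MvPolynomial σ ℝ≥0) (Y : σ → MaxPlus) : MaxPlus :=
  f.support.sup (tropWeight Y)

theorem tropWeight_eq_bot {Y : σ → MaxPlus} {s : σ →₀ ℕ} {v : σ} (hv : Y v = ⊥) (hs : s v ≠ 0) :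
    tropWeight Y s = ⊥ :=
  MaxPlus.sum_eq_bot (Finset.mem_univ v) (by rw [hv, MaxPlus.nsmul_bot hs])

theorem tropWeight_coe (y : σ → ℝ) (s : σ →₀ ℕ) :
    tropWeight (fun v => (y v : MaxPlus)) s = ((∑ v, s v * y v : ℝ) : MaxPlus) := by
  simp_rw [MaxPlus.coe_sum, ← MaxPlus.nsmul_coe]
  rfl

theorem tropWeight_add (Y Z : σ → MaxPlus) (s : σ →₀ ℕ) :
    tropWeight (fun v => Y v + Z v) s = tropWeight Y s + tropWeight Z s := by
  simp [tropWeight, Finset.sum_add_distrib]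

theorem exists_tropWeight_eq_tropEval {f : MvPolynomial σ ℝ≥0} (hf : f ≠ 0) (Y : σ → MaxPlus) :
    ∃ s ∈ f.support, tropWeight Y s = tropEval f Y := by
  obtain ⟨s, hs, h⟩ := Finset.exists_mem_eq_sup f.support
    (Finset.nonempty_iff_ne_empty.2 (by simpa using hf)) (tropWeight Y)
  exact ⟨s, hs, h.symm⟩

theorem tropWeight_le_tropEval {f : MvPolynomial σ ℝ≥0} {s : σ →₀ ℕ} (hs : s ∈ f.support)
    (Y : σ → MaxPlus) : tropWeight Y s ≤ tropEval f Y :=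
  Finset.le_sup (f := tropWeight Y) hs

theorem continuous_tropWeight (s : σ →₀ ℕ) : Continuous fun Y : σ → MaxPlus => tropWeight Y s :=
  continuous_finsetSum _ fun v _ => (continuous_apply v).const_smul (s v)

theorem continuous_tropEval (f : MvPolynomial σ ℝ≥0) :
    Continuous (tropEval f) :=
  Continuous.finset_sup_apply fun s _ => continuous_tropWeight s

end TropEval

/-! ### The non-differentiability locus of a tropical polynomial -/

section NonDiffLocus

variable {ι κ : Type*} [Fintype ι] [Fintype κ]

/-- The point with variables `X` and parameters `A`. -/
def withParams (A : κ → ℚ) (X : ι → MaxPlus) : ι ⊕ κ → MaxPlus :=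
  Sum.elim X fun j => (((A j : ℚ) : ℝ) : MaxPlus)

theorem tropWeight_withParams_add (A : κ → ℚ) (P : ι → MaxPlus) (v : ι → ℝ) (s : ι ⊕ κ →₀ ℕ) :
    tropWeight (withParams A fun i => P i + (v i : MaxPlus)) s =
      tropWeight (withParams A P) s + ((∑ i, s (Sum.inl i) * v i : ℝ) : MaxPlus) := by
  have h : (withParams A fun i => P i + (v i : MaxPlus)) =
      fun x => withParams A P x + ((Sum.elim v (fun _ => 0) x : ℝ) : MaxPlus) := by
    funext x
    rcases x with i | j
    · rfl
    · exact (add_zero _).symm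
  rw [h, tropWeight_add, tropWeight_coe]
  simp

theorem tropDifferentiableAt_iff {G : (ι → MaxPlus) → EReal} {P : ι → MaxPlus} :
    TropDifferentiableAt G P ↔ ∃ h : (ι → ℝ) → ℝ, DifferentiableAt ℝ h 0 ∧
      ∀ᶠ v in 𝓝 0, G (fun i => P i + (v i : MaxPlus)) = (h v : EReal) := by
  constructor
  · rintro ⟨h1, h2⟩
    exact ⟨_, h2, h1.mono fun v hv => (EReal.coe_toReal hv.2 hv.1).symm⟩
  · rintro ⟨h, h1, h2⟩
    refine ⟨h2.mono fun v hv => by simp [hv], h1.congr_of_eventuallyEq (h2.mono fun v hv => ?_)⟩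
    simp [hv]

/-- Minus the supporting line, `h` has a local minimum at `0`. -/
theorem eq_of_hasDerivAt_of_forall_le {h : ℝ → ℝ} {a d : ℝ} (hd : HasDerivAt h d 0)
    (hle : ∀ᶠ t in 𝓝 0, h 0 + a * t ≤ h t) : d = a := by
  have h1 : HasDerivAt (fun t => h t - a * t) (d - a * 1) 0 :=
    hd.sub ((hasDerivAt_id 0).const_mul a)
  have h2 : IsLocalMin (fun t => h t - a * t) 0 := by
    filter_upwards [hle] with t ht
    simp only [mul_zero, sub_zero]
    linarith
  have := h2.hasDerivAt_eq_zero h1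
  linarith

/-- The tropical polynomial function is not differentiable exactly where it is `-∞` or where
two monomials with different exponents attain the maximum. -/
theorem mem_nonDiffLocus_iff {f : MvPolynomial (ι ⊕ κ) ℝ≥0} (hf : f ≠ 0) (A : κ → ℚ)
    (P : ι → MaxPlus) :
    P ∈ nonDiffLocus (fixParams (fun X => (tropEval f X).toEReal) A) ↔
      tropEval f (withParams A P) = ⊥ ∨ ∃ s ∈ f.support, ∃ s' ∈ f.support, ∃ i,
        tropWeight (withParams A P) s = tropEval f (withParams A P) ∧
        tropWeight (withParams A P) s' = tropEval f (withParams A P) ∧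
        s (Sum.inl i) ≠ s' (Sum.inl i) := by
  classical
  set T := tropEval f (withParams A P) with hT
  have hG : ∀ v : ι → ℝ, fixParams (fun X => (tropEval f X).toEReal) A
      (fun i => P i + (v i : MaxPlus)) =
      (tropEval f (withParams A fun i => P i + (v i : MaxPlus))).toEReal := fun v => rfl
  have hP0 : (fun i => P i + (((0 : ι → ℝ) i : ℝ) : MaxPlus)) = P := by
    funext i; exact add_zero _
  rw [nonDiffLocus, Set.mem_ofPred_eq, not_iff_comm, tropDifferentiableAt_iff]
  push Not
  constructor
  · rintro ⟨hT0, hact⟩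
    obtain ⟨s, hs, hsT⟩ := exists_tropWeight_eq_tropEval hf (withParams A P)
    rw [← hT] at hsT
    obtain ⟨M, hM⟩ := WithBot.ne_bot_iff_exists.1 hT0
    -- Near `P` a single maximal monomial `s` determines the function: other maximal monomials have
    -- the same linear part, and the remaining ones stay below.
    refine ⟨fun v => M + ∑ i, s (Sum.inl i) * v i, by fun_prop, ?_⟩
    have hcont : ∀ (m : ℝ) (s : ι ⊕ κ →₀ ℕ),
        Continuous fun v : ι → ℝ => m + ∑ i, s (Sum.inl i) * v i := fun m s =>
      continuous_const.add (continuous_finsetSum _ fun i _ =>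
        continuous_const.mul (continuous_apply i))
    have hdom : ∀ s' ∈ f.support, ∀ᶠ v : ι → ℝ in 𝓝 0,
        tropWeight (withParams A P) s' + ((∑ i, s' (Sum.inl i) * v i : ℝ) : MaxPlus) ≤
          ((M + ∑ i, s (Sum.inl i) * v i : ℝ) : MaxPlus) := by
      intro s' hs'
      rcases (hT ▸ tropWeight_le_tropEval hs' (withParams A P)).eq_or_lt with h | h
      · refine Eventually.of_forall fun v => le_of_eq ?_
        rw [h, ← hM, WithBot.coe_add]
        simp_rw [hact s hs s' hs' _ hsT h]
      · by_cases hb : tropWeight (withParams A P) s' = ⊥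
        · simp [hb]
        · obtain ⟨m, hm⟩ := WithBot.ne_bot_iff_exists.1 hb
          rw [← hm, ← hM, WithBot.coe_lt_coe] at h
          rw [← hm]
          have : ∀ᶠ v : ι → ℝ in 𝓝 0, m + ∑ i, s' (Sum.inl i) * v i <
              M + ∑ i, s (Sum.inl i) * v i := by
            refine (hcont m s').continuousAt.eventually_lt (hcont M s).continuousAt ?_
            simpa using h
          filter_upwards [this] with v hv
          rw [← WithBot.coe_add]
          exact WithBot.coe_le_coe.2 hv.le
    filter_upwards [(Finset.eventually_all f.support).2 hdom] with v hv
    rw [hG, ← MaxPlus.toEReal_coe]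
    congr 1
    refine le_antisymm (Finset.sup_le fun s' hs' => ?_) ?_
    · rw [tropWeight_withParams_add]
      exact hv s' hs'
    · refine le_trans (le_of_eq ?_) (tropWeight_le_tropEval hs _)
      rw [tropWeight_withParams_add, hsT, ← hM, WithBot.coe_add]
  · rintro ⟨h, hd, hev⟩
    have h0 := hev.self_of_nhds
    rw [hG, hP0, ← hT] at h0
    have hTh : T = (h 0 : MaxPlus) := by
      induction hTM : T using WithBot.recBotCoe with
      | bot => rw [hTM] at h0; simp at h0
      | coe M => rw [hTM] at h0; simpa using h0
    refine ⟨by simp [hTh], fun s hs s' hs' i hsT hsT' => ?_⟩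
    -- Every maximal monomial touches the function from below at `P`, so its exponents are the
    -- partial derivatives there.
    have key : ∀ s ∈ f.support, tropWeight (withParams A P) s = T →
        fderiv ℝ h 0 (Pi.single i 1) = s (Sum.inl i) := by
      intro s hs hsT
      have hcomp : HasDerivAt (fun t : ℝ => h (t • Pi.single i (1 : ℝ)))
          (fderiv ℝ h 0 (Pi.single i 1)) 0 := by
        have h1 : HasDerivAt (fun t : ℝ => t • (Pi.single i 1 : ι → ℝ))
            ((1 : ℝ) • Pi.single i (1 : ℝ)) 0 := (hasDerivAt_id (0 : ℝ)).smul_const _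
        rw [one_smul] at h1
        have h2 : HasFDerivAt h (fderiv ℝ h 0) ((0 : ℝ) • (Pi.single i 1 : ι → ℝ)) := by
          rw [zero_smul]; exact hd.hasFDerivAt
        exact h2.comp_hasDerivAt 0 h1
      refine eq_of_hasDerivAt_of_forall_le hcomp ?_
      have htend : Tendsto (fun t : ℝ => t • (Pi.single i 1 : ι → ℝ)) (𝓝 0) (𝓝 0) := by
        have : Continuous fun t : ℝ => t • (Pi.single i 1 : ι → ℝ) := by fun_prop
        simpa using this.tendsto 0
      filter_upwards [htend.eventually hev] with t ht
      have hle := tropWeight_le_tropEval hs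
        (withParams A fun j => P j + ((((t • (Pi.single i 1 : ι → ℝ)) j : ℝ)) : MaxPlus))
      rw [hG] at ht
      have hval : tropEval f (withParams A fun j =>
          P j + ((((t • (Pi.single i 1 : ι → ℝ)) j : ℝ)) : MaxPlus)) =
          (h (t • Pi.single i 1) : MaxPlus) := by
        revert ht
        induction tropEval f (withParams A fun j =>
          P j + ((((t • (Pi.single i 1 : ι → ℝ)) j : ℝ)) : MaxPlus))
          using WithBot.recBotCoe with
        | bot => simp
        | coe M => simp
      rw [hval, tropWeight_withParams_add, hsT, hTh, ← WithBot.coe_add, WithBot.coe_le_coe] at hle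
      simpa [Pi.single_apply] using hle
    have := (key s hs hsT).symm.trans (key s' hs' hsT')
    exact_mod_cast this

/-- By the criterion, the locus is a finite union of sets cut out by equalities between continuous
functions. -/
theorem isClosed_nonDiffLocus {f : MvPolynomial (ι ⊕ κ) ℝ≥0} (hf : f ≠ 0) (A : κ → ℚ) :
    IsClosed (nonDiffLocus (fixParams (ι := ι) (fun X => (tropEval f X).toEReal) A)) := by
  have hc : Continuous fun P : ι → MaxPlus => withParams A P := by
    refine continuous_pi fun x => ?_
    rcases x with i | j
    · exact continuous_apply i
    · exact continuous_const
  have hT := (continuous_tropEval f).comp hc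
  have hw := fun s => (continuous_tropWeight s).comp hc
  have hset : nonDiffLocus (fixParams (ι := ι) (fun X => (tropEval f X).toEReal) A) =
      {P | tropEval f (withParams A P) = ⊥} ∪ ⋃ s ∈ f.support, ⋃ s' ∈ f.support,
        {P | tropWeight (withParams A P) s = tropEval f (withParams A P) ∧
          tropWeight (withParams A P) s' = tropEval f (withParams A P) ∧
          ∃ i, s (Sum.inl i) ≠ s' (Sum.inl i)} := by
    ext P
    rw [mem_nonDiffLocus_iff hf]
    simp only [Set.mem_union, Set.mem_ofPred_eq, Set.mem_iUnion, exists_prop]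
    refine or_congr Iff.rfl ?_
    constructor
    · rintro ⟨s, hs, s', hs', i, h1, h2, h3⟩
      exact ⟨s, hs, s', hs', h1, h2, i, h3⟩
    · rintro ⟨s, hs, s', hs', h1, h2, i, h3⟩
      exact ⟨s, hs, s', hs', i, h1, h2, h3⟩
  rw [hset]
  refine (isClosed_eq hT continuous_const).union ?_
  refine isClosed_biUnion_finset fun s _ => isClosed_biUnion_finset fun s' _ => ?_
  exact (isClosed_eq (hw s) hT).inter ((isClosed_eq (hw s') hT).inter isClosed_const)

end NonDiffLocus

/-! ### Density of the rational points in the locus -/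

section RationalDensity

/-- Take a Hamel basis containing `1`, keep `1` fixed and approximate every other basis element by
rationals. Each real number involves only finitely many basis elements, so convergence is pointwise
everywhere. -/
theorem exists_ratLinear_tendsto :
    ∃ φ : ℕ → (ℝ →ₗ[ℚ] ℚ), (∀ n, φ n 1 = 1) ∧
      ∀ x, Tendsto (fun n => ((φ n x : ℚ) : ℝ)) atTop (𝓝 x) := by
  have hlin : LinearIndepOn ℚ id ({1} : Set ℝ) := LinearIndepOn.singleton one_ne_zero
  set b := Module.Basis.extend hlin with hb
  have hq : ∀ y : ℝ, ∃ q : ℕ → ℚ, (y = 1 → ∀ n, q n = 1) ∧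
      Tendsto (fun n => (q n : ℝ)) atTop (𝓝 y) := by
    intro y
    by_cases hy : y = 1
    · exact ⟨fun _ => 1, fun _ _ => rfl, by simp [hy]⟩
    · have h : ∀ n : ℕ, ∃ q : ℚ, y < q ∧ (q : ℝ) < y + 1 / ((n : ℝ) + 1) := fun n =>
        exists_rat_btwn (by have : (0 : ℝ) < 1 / ((n : ℝ) + 1) := by positivity
                            linarith)
      choose q hq1 hq2 using h
      refine ⟨q, fun h => absurd h hy, ?_⟩
      refine tendsto_of_tendsto_of_tendsto_of_le_of_le tendsto_const_nhds ?_
        (fun n => (hq1 n).le) (fun n => (hq2 n).le)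
      have := (tendsto_const_nhds (x := y)).add
        (tendsto_one_div_add_atTop_nhds_zero_nat (𝕜 := ℝ))
      rwa [add_zero] at this
  choose q hq1 hq using hq
  refine ⟨fun n => b.constr ℚ fun j => q (b j) n, fun n => ?_, fun x => ?_⟩
  · have h1 : (1 : ℝ) ∈ hlin.extend (Set.subset_univ _) :=
      hlin.subset_extend _ rfl
    have h2 : b ⟨1, h1⟩ = 1 := Module.Basis.extend_apply_self hlin ⟨1, h1⟩
    calc b.constr ℚ (fun j => q (b j) n) 1 = b.constr ℚ (fun j => q (b j) n) (b ⟨1, h1⟩) := by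
          rw [h2]
      _ = 1 := by rw [Module.Basis.constr_basis, hq1 _ h2]
  · have h1 : ∀ n, ((b.constr ℚ (fun j => q (b j) n) x : ℚ) : ℝ) =
        ∑ j ∈ (b.repr x).support, (b.repr x j : ℝ) * (q (b j) n : ℝ) := by
      intro n
      rw [Module.Basis.constr_apply, Finsupp.sum]
      push_cast
      simp
    have h2 : x = ∑ j ∈ (b.repr x).support, (b.repr x j : ℝ) * b j := by
      conv_lhs => rw [← b.linearCombination_repr x, Finsupp.linearCombination_apply, Finsupp.sum]
      simp [Rat.smul_def]
    simp_rw [h1]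
    conv => enter [3, 1]; rw [h2]
    exact tendsto_finsetSum _ fun j _ => (hq (b j)).const_mul _

variable {ι κ : Type*} [Fintype ι] [Fintype κ]

/-- The maps `φ n`, extended by `⊥ ↦ ⊥`, fix the rational parameters and commute with monomial
weights. They carry `P` to rational points at which equal weights are still equal. -/
theorem nonDiffLocus_subset_closure {f : MvPolynomial (ι ⊕ κ) ℝ≥0} (hf : f ≠ 0) (A : κ → ℚ) :
    nonDiffLocus (fixParams (fun X => (tropEval f X).toEReal) A) ⊆
      closure (nonDiffLocus (fixParams (fun X => (tropEval f X).toEReal) A) ∩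
        rationalPoints ι) := by
  intro P hP
  obtain ⟨φ, hφ1, hφ⟩ := exists_ratLinear_tendsto
  let c : ℕ → ℝ →+ ℝ := fun n => (Rat.castHom ℝ).toAddMonoidHom.comp (φ n).toAddMonoidHom
  let ψ : ℕ → MaxPlus →+ MaxPlus := fun n => (c n).withBotMap
  have hψ_coe : ∀ n (r : ℝ), ψ n (r : MaxPlus) = ((φ n r : ℝ) : MaxPlus) := fun n r => rfl
  have hψ_bot : ∀ n, ψ n ⊥ = ⊥ := fun n => rfl
  have hψ_rat : ∀ n (q : ℚ), ψ n ((q : ℝ) : MaxPlus) = ((q : ℝ) : MaxPlus) := by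
    intro n q
    have : φ n (q : ℝ) = q := by
      have h := (φ n).map_smul q 1
      rw [hφ1, Rat.smul_def, mul_one, smul_eq_mul, mul_one] at h
      exact h
    rw [hψ_coe, this]
  let Q : ℕ → ι → MaxPlus := fun n i => ψ n (P i)
  have hQ : Tendsto Q atTop (𝓝 P) := by
    refine tendsto_pi_nhds.2 fun i => ?_
    change Tendsto (fun n => ψ n (P i)) atTop (𝓝 (P i))
    induction P i using WithBot.recBotCoe with
    | bot => simp only [hψ_bot]; exact tendsto_const_nhds
    | coe r =>
      simp only [hψ_coe]
      exact (MaxPlus.continuous_coe.tendsto r).comp (hφ r)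
  have hparams : ∀ n, withParams A (Q n) = fun x => ψ n (withParams A P x) := by
    intro n
    funext x
    rcases x with i | j
    · rfl
    · exact (hψ_rat n (A j)).symm
  have hw : ∀ n s, tropWeight (withParams A (Q n)) s = ψ n (tropWeight (withParams A P) s) := by
    intro n s
    simp [hparams, tropWeight, map_sum, map_nsmul]
  have hwt : ∀ s, Tendsto (fun n => tropWeight (withParams A (Q n)) s) atTop
      (𝓝 (tropWeight (withParams A P) s)) := by
    intro s
    refine ((continuous_tropWeight s).tendsto _).comp (tendsto_pi_nhds.2 fun x => ?_)
    rcases x with i | j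
    · exact tendsto_pi_nhds.1 hQ i
    · exact tendsto_const_nhds
  refine mem_closure_of_tendsto hQ ?_
  have hrat : ∀ n, Q n ∈ rationalPoints ι := by
    intro n i
    change ψ n (P i) = ⊥ ∨ ∃ q : ℚ, ψ n (P i) = _
    induction P i using WithBot.recBotCoe with
    | bot => exact Or.inl rfl
    | coe r => exact Or.inr ⟨φ n r, rfl⟩
  suffices h : ∀ᶠ n in atTop,
      Q n ∈ nonDiffLocus (fixParams (fun X => (tropEval f X).toEReal) A) from
    h.mono fun n hn => ⟨hn, hrat n⟩
  rcases (mem_nonDiffLocus_iff hf A P).1 hP with h | ⟨s, hs, s', hs', i, h1, h2, h3⟩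
  · refine Eventually.of_forall fun n => (mem_nonDiffLocus_iff hf A _).2 (Or.inl ?_)
    rw [tropEval, Finset.sup_eq_bot_iff] at h ⊢
    intro u hu
    rw [hw, h u hu, hψ_bot]
  -- The maps `ψ n` need not be monotone. The tie between `s` and `s'` holds for every `n`, but the
  -- maximality of `s` only for large `n`, by convergence of finitely many weights.
  · have hle : ∀ u ∈ f.support, ∀ᶠ n in atTop,
        tropWeight (withParams A (Q n)) u ≤ tropWeight (withParams A (Q n)) s := by
      intro u hu
      rcases (tropWeight_le_tropEval hu (withParams A P)).eq_or_lt with h | h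
      · exact Eventually.of_forall fun n => by rw [hw, hw, h, h1]
      · rw [← h1] at h
        exact ((hwt u).eventually_lt (hwt s) h).mono fun n hn => hn.le
    filter_upwards [(Finset.eventually_all f.support).2 hle] with n hn
    have hT : tropWeight (withParams A (Q n)) s = tropEval f (withParams A (Q n)) :=
      le_antisymm (tropWeight_le_tropEval hs _) (Finset.sup_le hn)
    exact (mem_nonDiffLocus_iff hf A _).2 (Or.inr ⟨s, hs, s', hs', i, hT,
      by rw [← hT, hw, hw, h1, h2], h3⟩)

end RationalDensity

/-! ### Existence and value of the ultradiscretizations -/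

section Ultradiscretization

theorem expScaled_bot (ε : ℝ) : expScaled ε ⊥ = 0 := rfl

theorem expScaled_coe (ε r : ℝ) : expScaled ε (r : MaxPlus) = ENNReal.ofReal (Real.exp (r / ε)) :=
  rfl

theorem expScaled_zero (ε : ℝ) : expScaled ε 0 = 1 := by
  have : expScaled ε 0 = ENNReal.ofReal (Real.exp (0 / ε)) := rfl
  simp [this]

theorem expScaled_add (ε : ℝ) (x y : MaxPlus) :
    expScaled ε (x + y) = expScaled ε x * expScaled ε y := by
  induction x using WithBot.recBotCoe with
  | bot => simp [expScaled_bot]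
  | coe x =>
    induction y using WithBot.recBotCoe with
    | bot => simp [expScaled_bot]
    | coe y =>
      rw [← WithBot.coe_add, expScaled_coe, expScaled_coe, expScaled_coe, add_div, Real.exp_add,
        ENNReal.ofReal_mul (Real.exp_pos _).le]

theorem expScaled_nsmul (ε : ℝ) (n : ℕ) (x : MaxPlus) :
    expScaled ε (n • x) = expScaled ε x ^ n := by
  induction n with
  | zero => simp [expScaled_zero]
  | succ n ih => rw [succ_nsmul, expScaled_add, ih, pow_succ]

theorem expScaled_sum (ε : ℝ) {α : Type*} (s : Finset α) (x : α → MaxPlus) :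
    expScaled ε (∑ a ∈ s, x a) = ∏ a ∈ s, expScaled ε (x a) := by
  classical
  induction s using Finset.induction_on with
  | empty => simp [expScaled_zero]
  | insert a s ha ih => rw [Finset.sum_insert ha, expScaled_add, ih, Finset.prod_insert ha]

theorem expScaled_mono {ε : ℝ} (hε : 0 < ε) : Monotone (expScaled ε) := by
  intro x y h
  induction x using WithBot.recBotCoe with
  | bot => simp [expScaled_bot]
  | coe x =>
    induction y using WithBot.recBotCoe with
    | bot => simp at h
    | coe y =>
      rw [expScaled_coe, expScaled_coe]
      refine ENNReal.ofReal_le_ofReal (Real.exp_le_exp.2 ?_)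
      have := WithBot.coe_le_coe.1 h
      gcongr

theorem expScaled_ne_top (ε : ℝ) (x : MaxPlus) : expScaled ε x ≠ ⊤ := by
  induction x using WithBot.recBotCoe with
  | bot => simp [expScaled_bot]
  | coe x => simp [expScaled_coe]

theorem expScaled_coe_ne_zero (ε r : ℝ) : expScaled ε (r : MaxPlus) ≠ 0 := by
  simp [expScaled_coe, Real.exp_pos]

theorem sfEval_expScaled {σ : Type*} [Fintype σ] (f : MvPolynomial σ ℝ≥0) (X : σ → MaxPlus)
    (ε : ℝ) : sfEval f (fun i => expScaled ε (X i)) =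
      ∑ s ∈ f.support, ((f.coeff s : ℝ≥0) : ℝ≥0∞) * expScaled ε (tropWeight X s) := by
  rw [sfEval, MvPolynomial.eval₂_eq']
  simp_rw [tropWeight, expScaled_sum, expScaled_nsmul]
  rfl

/-- Below, keep one maximal monomial; above, replace all monomials by the maximal one. The constants
do not depend on `ε`, so they contribute only `ε log a → 0`. -/
theorem exists_sfEval_bounds {σ : Type*} [Fintype σ] {f : MvPolynomial σ ℝ≥0} (hf : f ≠ 0)
    (X : σ → MaxPlus) : ∃ a b : ℝ≥0, a ≠ 0 ∧ b ≠ 0 ∧ ∀ ε : ℝ, 0 < ε →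
      a * expScaled ε (tropEval f X) ≤ sfEval f (fun i => expScaled ε (X i)) ∧
      sfEval f (fun i => expScaled ε (X i)) ≤ b * expScaled ε (tropEval f X) := by
  obtain ⟨s, hs, hsT⟩ := exists_tropWeight_eq_tropEval hf X
  have hs0 : f.coeff s ≠ 0 := MvPolynomial.mem_support_iff.1 hs
  refine ⟨f.coeff s, ∑ s ∈ f.support, f.coeff s, hs0, ?_, fun ε hε => ⟨?_, ?_⟩⟩
  · exact (lt_of_lt_of_le (pos_iff_ne_zero.2 hs0)
      (Finset.single_le_sum (f := fun s => f.coeff s) (fun _ _ => zero_le) hs)).ne'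
  · rw [sfEval_expScaled, ← hsT]
    exact Finset.single_le_sum
      (f := fun s => ((f.coeff s : ℝ≥0) : ℝ≥0∞) * expScaled ε (tropWeight X s)) (fun _ _ => zero_le) hs
  · rw [sfEval_expScaled, ENNReal.ofNNReal_finsetSum, Finset.sum_mul]
    refine Finset.sum_le_sum fun u hu => ?_
    gcongr
    exact expScaled_mono hε (tropWeight_le_tropEval hu X)

theorem log_mul_expScaled_coe {a : ℝ≥0} (ha : a ≠ 0) (ε m : ℝ) :
    ENNReal.log (a * expScaled ε (m : MaxPlus)) = ((Real.log a + m / ε : ℝ) : EReal) := by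
  have ha' : (0 : ℝ) < a := by exact_mod_cast pos_iff_ne_zero.2 ha
  have h : (a : ℝ≥0∞) * expScaled ε (m : MaxPlus) = ENNReal.ofReal (a * Real.exp (m / ε)) := by
    rw [expScaled_coe, ENNReal.ofReal_mul ha'.le, ENNReal.ofReal_coe_nnreal]
  rw [h, ENNReal.log_ofReal_of_pos (by positivity), Real.log_mul ha'.ne' (Real.exp_pos _).ne',
    Real.log_exp]

theorem tendsto_mul_log_of_bounds {g : ℝ → ℝ≥0∞} {M : MaxPlus} {a b : ℝ≥0} (ha : a ≠ 0)
    (hb : b ≠ 0) (h : ∀ ε : ℝ, 0 < ε → a * expScaled ε M ≤ g ε ∧ g ε ≤ b * expScaled ε M) :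
    Tendsto (fun ε : ℝ => (ε : EReal) * ENNReal.log (g ε)) (𝓝[>] 0) (𝓝 M.toEReal) := by
  induction M using WithBot.recBotCoe with
  | bot =>
    refine tendsto_const_nhds.congr' ?_
    filter_upwards [self_mem_nhdsWithin] with ε hε
    have := (h ε hε).2
    rw [expScaled_bot, mul_zero, nonpos_iff_eq_zero] at this
    rw [this, ENNReal.log_zero, EReal.coe_mul_bot_of_pos hε, MaxPlus.toEReal_bot]
  | coe m =>
    have hlim : ∀ {a : ℝ≥0}, a ≠ 0 → Tendsto
        (fun ε : ℝ => (ε : EReal) * ENNReal.log (a * expScaled ε (m : MaxPlus))) (𝓝[>] 0)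
        (𝓝 (m : EReal)) := by
      intro a ha
      have h1 : Tendsto (fun ε : ℝ => ε * Real.log a + m) (𝓝[>] 0) (𝓝 m) := by
        have : Continuous fun ε : ℝ => ε * Real.log a + m := by fun_prop
        simpa using (this.tendsto 0).mono_left nhdsWithin_le_nhds
      refine ((continuous_coe_real_ereal.tendsto m).comp h1).congr' ?_
      filter_upwards [self_mem_nhdsWithin] with ε hε
      rw [log_mul_expScaled_coe ha, ← EReal.coe_mul, Function.comp]
      congr 1
      have : ε ≠ 0 := ne_of_gt hε
      field_simp
    refine tendsto_of_tendsto_of_tendsto_of_le_of_le' (hlim ha) (hlim hb) ?_ ?_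
    · filter_upwards [self_mem_nhdsWithin] with ε hε
      exact mul_le_mul_of_nonneg_left (ENNReal.log_monotone (h ε hε).1)
        (EReal.coe_nonneg.2 (le_of_lt hε))
    · filter_upwards [self_mem_nhdsWithin] with ε hε
      exact mul_le_mul_of_nonneg_left (ENNReal.log_monotone (h ε hε).2)
        (EReal.coe_nonneg.2 (le_of_lt hε))

/-- For real `M₁` the quotient obeys bounds of the same kind at `M₀ - M₁`. For `M₁ = ⊥` the
conventions match: `0 / 0 = 0` goes with `⊥ - ⊥ = ⊥`, and a nonzero numerator over `0` with `m - ⊥ =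
⊤`. -/
theorem tendsto_mul_log_div_of_bounds {g₀ g₁ : ℝ → ℝ≥0∞} {M₀ M₁ : MaxPlus} {a₀ b₀ a₁ b₁ : ℝ≥0}
    (ha₀ : a₀ ≠ 0) (hb₀ : b₀ ≠ 0) (ha₁ : a₁ ≠ 0) (hb₁ : b₁ ≠ 0)
    (h₀ : ∀ ε : ℝ, 0 < ε → a₀ * expScaled ε M₀ ≤ g₀ ε ∧ g₀ ε ≤ b₀ * expScaled ε M₀)
    (h₁ : ∀ ε : ℝ, 0 < ε → a₁ * expScaled ε M₁ ≤ g₁ ε ∧ g₁ ε ≤ b₁ * expScaled ε M₁) :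
    Tendsto (fun ε : ℝ => (ε : EReal) * ENNReal.log (g₀ ε / g₁ ε)) (𝓝[>] 0)
      (𝓝 (M₀.toEReal - M₁.toEReal)) := by
  induction M₁ using WithBot.recBotCoe with
  | bot =>
    have hg₁ : ∀ ε : ℝ, 0 < ε → g₁ ε = 0 := fun ε hε => by
      simpa [expScaled_bot] using (h₁ ε hε).2
    refine tendsto_const_nhds.congr' ?_
    filter_upwards [self_mem_nhdsWithin] with ε hε
    rw [hg₁ ε hε]
    induction M₀ using WithBot.recBotCoe with
    | bot =>
      have hg₀ : g₀ ε = 0 := by simpa [expScaled_bot] using (h₀ ε hε).2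
      rw [hg₀, ENNReal.zero_div, ENNReal.log_zero, EReal.coe_mul_bot_of_pos hε]
      simp
    | coe m =>
      have hg₀ : g₀ ε ≠ 0 := by
        refine (lt_of_lt_of_le (pos_iff_ne_zero.2 (mul_ne_zero ?_ ?_)) (h₀ ε hε).1).ne'
        · exact_mod_cast ha₀
        · exact expScaled_coe_ne_zero ε m
      rw [ENNReal.div_zero hg₀, ENNReal.log_top, EReal.coe_mul_top_of_pos hε]
      simp
  | coe m₁ =>
    have hM : (M₀ + ((-m₁ : ℝ) : MaxPlus)).toEReal = M₀.toEReal - MaxPlus.toEReal (m₁ : MaxPlus) := by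
      induction M₀ using WithBot.recBotCoe with
      | bot => simp
      | coe m =>
        rw [← WithBot.coe_add, ← sub_eq_add_neg]
        rfl
    rw [← hM]
    have hdiv : ∀ (ε : ℝ) (a b : ℝ≥0), b ≠ 0 →
        (a * expScaled ε M₀) / (b * expScaled ε (m₁ : MaxPlus)) =
          ((a / b : ℝ≥0) : ℝ≥0∞) * expScaled ε (M₀ + ((-m₁ : ℝ) : MaxPlus)) := by
      intro ε a b hb
      have : expScaled ε M₀ =
          expScaled ε (M₀ + ((-m₁ : ℝ) : MaxPlus)) * expScaled ε (m₁ : MaxPlus) := by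
        rw [← expScaled_add, add_assoc, ← WithBot.coe_add, neg_add_cancel]
        simp
      rw [this, ← mul_assoc, ENNReal.mul_div_mul_right _ _ (expScaled_coe_ne_zero ε m₁)
        (expScaled_ne_top ε _), ENNReal.mul_div_right_comm, ENNReal.coe_div hb]
    refine tendsto_mul_log_of_bounds (a := a₀ / b₁) (b := b₀ / a₁) (div_ne_zero ha₀ hb₁)
      (div_ne_zero hb₀ ha₁) fun ε hε => ⟨?_, ?_⟩
    · rw [← hdiv ε _ _ hb₁]
      exact ENNReal.div_le_div (h₀ ε hε).1 (h₁ ε hε).2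
    · rw [← hdiv ε _ _ ha₁]
      exact ENNReal.div_le_div (h₀ ε hε).2 (h₁ ε hε).1

variable {σ : Type*} [Fintype σ]

theorem isUltradiscretization_sfEval {f : MvPolynomial σ ℝ≥0} (hf : f ≠ 0) :
    IsUltradiscretization (sfEval f) fun X => (tropEval f X).toEReal := by
  intro X
  obtain ⟨a, b, ha, hb, h⟩ := exists_sfEval_bounds hf X
  exact tendsto_mul_log_of_bounds ha hb h

theorem isUltradiscretization_sfEval_div {f₀ f₁ : MvPolynomial σ ℝ≥0} (hf₀ : f₀ ≠ 0)
    (hf₁ : f₁ ≠ 0) : IsUltradiscretization (fun x => sfEval f₀ x / sfEval f₁ x)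
      fun X => (tropEval f₀ X).toEReal - (tropEval f₁ X).toEReal := by
  intro X
  obtain ⟨a₀, b₀, ha₀, hb₀, h₀⟩ := exists_sfEval_bounds hf₀ X
  obtain ⟨a₁, b₁, ha₁, hb₁, h₁⟩ := exists_sfEval_bounds hf₁ X
  exact tendsto_mul_log_div_of_bounds ha₀ hb₀ ha₁ hb₁ h₀ h₁

end Ultradiscretization

/-! ### The valuation, and series with nonnegative coefficients -/

section Valuation

theorem nu_zero : nu 0 = ⊥ := if_pos rfl

theorem nu_of_ne_zero {x : AlgFun} (hx : x ≠ 0) :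
    nu x = ((-((x : HahnSeries ℚ ℂ).order : ℝ) : ℝ) : MaxPlus) := if_neg hx

theorem nu_eq_bot {x : AlgFun} : nu x = ⊥ ↔ x = 0 := by
  refine ⟨fun h => ?_, fun h => h ▸ nu_zero⟩
  by_contra hx
  rw [nu_of_ne_zero hx] at h
  exact WithBot.coe_ne_bot h

theorem coe_algFun_ne_zero {x : AlgFun} (hx : x ≠ 0) : (x : HahnSeries ℚ ℂ) ≠ 0 :=
  fun h => hx (Subtype.ext h)

theorem nu_mul (x y : AlgFun) : nu (x * y) = nu x + nu y := by
  by_cases hx : x = 0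
  · simp [hx, nu_zero]
  by_cases hy : y = 0
  · simp [hy, nu_zero]
  rw [nu_of_ne_zero hx, nu_of_ne_zero hy, nu_of_ne_zero (mul_ne_zero hx hy), ← WithBot.coe_add]
  have : ((x * y : AlgFun) : HahnSeries ℚ ℂ).order =
      (x : HahnSeries ℚ ℂ).order + (y : HahnSeries ℚ ℂ).order :=
    HahnSeries.order_mul (coe_algFun_ne_zero hx) (coe_algFun_ne_zero hy)
  rw [this, Rat.cast_add, neg_add]

theorem nu_one : nu 1 = 0 := by
  rw [nu_of_ne_zero one_ne_zero]
  have : ((1 : AlgFun) : HahnSeries ℚ ℂ).order = 0 := HahnSeries.order_one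
  rw [this]
  simp

theorem nu_pow (x : AlgFun) (n : ℕ) : nu (x ^ n) = n • nu x := by
  induction n with
  | zero => simp [nu_one]
  | succ n ih => rw [pow_succ, nu_mul, ih, succ_nsmul]

theorem nu_prod {α : Type*} (s : Finset α) (x : α → AlgFun) :
    nu (∏ a ∈ s, x a) = ∑ a ∈ s, nu (x a) := by
  classical
  induction s using Finset.induction_on with
  | empty => simp [nu_one]
  | insert a s ha ih => rw [Finset.prod_insert ha, nu_mul, ih, Finset.sum_insert ha]

theorem nu_neg (x : AlgFun) : nu (-x) = nu x := by
  by_cases hx : x = 0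
  · simp [hx]
  rw [nu_of_ne_zero hx, nu_of_ne_zero (neg_ne_zero.2 hx)]
  have : ((-x : AlgFun) : HahnSeries ℚ ℂ).order = (x : HahnSeries ℚ ℂ).order :=
    HahnSeries.order_neg
  rw [this]

theorem le_nu_of_coeff_ne_zero {x : AlgFun} {q : ℚ} (h : (x : HahnSeries ℚ ℂ).coeff q ≠ 0) :
    ((-(q : ℝ) : ℝ) : MaxPlus) ≤ nu x := by
  have hx : x ≠ 0 := by
    rintro rfl
    exact h rfl
  rw [nu_of_ne_zero hx, WithBot.coe_le_coe, neg_le_neg_iff]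
  exact_mod_cast HahnSeries.order_le_of_coeff_ne_zero h

theorem exists_coeff_ne_zero_of_ne_zero {x : AlgFun} (hx : x ≠ 0) :
    ∃ q : ℚ, (x : HahnSeries ℚ ℂ).coeff q ≠ 0 ∧ nu x = ((-(q : ℝ) : ℝ) : MaxPlus) :=
  ⟨_, HahnSeries.coeff_order_eq_zero.not.2 (coe_algFun_ne_zero hx), nu_of_ne_zero hx⟩

theorem nu_add_le (x y : AlgFun) : nu (x + y) ≤ max (nu x) (nu y) := by
  by_cases h : x + y = 0
  · rw [h, nu_zero]
    exact bot_le
  obtain ⟨q, hq, hnu⟩ := exists_coeff_ne_zero_of_ne_zero h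
  rw [hnu]
  have hadd : ((x + y : AlgFun) : HahnSeries ℚ ℂ).coeff q =
      (x : HahnSeries ℚ ℂ).coeff q + (y : HahnSeries ℚ ℂ).coeff q := rfl
  by_cases hx : (x : HahnSeries ℚ ℂ).coeff q = 0
  · refine (le_nu_of_coeff_ne_zero fun hy => hq ?_).trans (le_max_right _ _)
    rw [hadd, hx, hy, add_zero]
  · exact (le_nu_of_coeff_ne_zero hx).trans (le_max_left _ _)

theorem nu_sum_lt {α : Type*} {s : Finset α} {x : α → AlgFun} {b : MaxPlus} (hb : b ≠ ⊥)
    (h : ∀ a ∈ s, nu (x a) < b) : nu (∑ a ∈ s, x a) < b := by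
  classical
  induction s using Finset.induction_on with
  | empty => rw [Finset.sum_empty, nu_zero]; exact bot_lt_iff_ne_bot.2 hb
  | insert a s ha ih =>
    rw [Finset.sum_insert ha]
    exact (nu_add_le _ _).trans_lt (max_lt (h a (Finset.mem_insert_self a s))
      (ih fun c hc => h c (Finset.mem_insert_of_mem hc)))

theorem nu_zPow (q : ℚ) : nu (zPow q) = ((-(q : ℝ) : ℝ) : MaxPlus) := by
  have h : HahnSeries.single q (1 : ℂ) ≠ 0 := by simp
  have hx : zPow q ≠ 0 := fun h' => h (congr_arg Subtype.val h')
  rw [nu_of_ne_zero hx]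
  have : (zPow q : HahnSeries ℚ ℂ).order = q := HahnSeries.order_single one_ne_zero
  rw [this]

theorem coe_constAlgFun (c : ℝ≥0) :
    (constAlgFun c : HahnSeries ℚ ℂ) = HahnSeries.single 0 ((c : ℝ) : ℂ) := by
  have : (constAlgFun c : HahnSeries ℚ ℂ) = algebraMap ℂ (HahnSeries ℚ ℂ) ((c : ℝ) : ℂ) := rfl
  rw [this, HahnSeries.algebraMap_apply', PowerSeries.algebraMap_apply, HahnSeries.ofPowerSeries_C]
  rfl

theorem nu_constAlgFun {c : ℝ≥0} (hc : c ≠ 0) : nu (constAlgFun c) = 0 := by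
  have hc' : ((c : ℝ) : ℂ) ≠ 0 := by exact_mod_cast hc
  have hx : constAlgFun c ≠ 0 := by
    intro h
    have := congr_arg Subtype.val h
    rw [coe_constAlgFun] at this
    exact HahnSeries.single_ne_zero hc' this
  rw [nu_of_ne_zero hx, coe_constAlgFun, HahnSeries.order_single hc']
  simp

theorem nu_mem_rationalPoints {ι : Type*} (x : ι → AlgFun) :
    (fun i => nu (x i)) ∈ rationalPoints ι := by
  intro i
  by_cases hx : x i = 0
  · exact Or.inl (nu_eq_bot.2 hx)
  · refine Or.inr ⟨-(x i : HahnSeries ℚ ℂ).order, ?_⟩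
    simp only [nu_of_ne_zero hx, Rat.cast_neg]

/-- The algebraic functions whose coefficients are nonnegative real numbers. -/
def nonnegAlgFun : Subsemiring AlgFun where
  carrier := {x | ∀ q, ∃ r : ℝ, 0 ≤ r ∧ (x : HahnSeries ℚ ℂ).coeff q = r}
  mul_mem' := by
    intro x y hx hy q
    choose r hr hr' using hx
    choose t ht ht' using hy
    refine ⟨∑ ij ∈ Finset.antidiagonal (x : HahnSeries ℚ ℂ).isPWO_support
      (y : HahnSeries ℚ ℂ).isPWO_support q, r ij.1 * t ij.2,
      Finset.sum_nonneg fun ij _ => mul_nonneg (hr _) (ht _), ?_⟩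
    change ((x : HahnSeries ℚ ℂ) * (y : HahnSeries ℚ ℂ)).coeff q = _
    rw [HahnSeries.coeff_mul]
    push_cast
    exact Finset.sum_congr rfl fun ij _ => by rw [hr', ht']
  one_mem' := by
    intro q
    change ∃ r : ℝ, 0 ≤ r ∧ (1 : HahnSeries ℚ ℂ).coeff q = r
    rw [HahnSeries.coeff_one]
    split_ifs
    · exact ⟨1, zero_le_one, by simp⟩
    · exact ⟨0, le_rfl, by simp⟩
  add_mem' := by
    intro x y hx hy q
    obtain ⟨r, hr, hr'⟩ := hx q
    obtain ⟨t, ht, ht'⟩ := hy q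
    refine ⟨r + t, add_nonneg hr ht, ?_⟩
    change (x : HahnSeries ℚ ℂ).coeff q + (y : HahnSeries ℚ ℂ).coeff q = _
    rw [hr', ht']
    push_cast
    rfl
  zero_mem' := fun q => ⟨0, le_rfl, by simp⟩

theorem single_mem_nonneg {x : AlgFun} {q : ℚ} {c : ℝ} (hc : 0 ≤ c)
    (hx : (x : HahnSeries ℚ ℂ) = HahnSeries.single q (c : ℂ)) : x ∈ nonnegAlgFun := by
  intro p
  rw [hx, HahnSeries.coeff_single]
  split_ifs
  · exact ⟨c, hc, rfl⟩
  · exact ⟨0, le_rfl, by simp⟩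

theorem zPow_mem_nonnegAlgFun (q : ℚ) : zPow q ∈ nonnegAlgFun :=
  single_mem_nonneg (q := q) (c := 1) zero_le_one (by simp [zPow])

theorem constAlgFun_mem_nonnegAlgFun (c : ℝ≥0) : constAlgFun c ∈ nonnegAlgFun :=
  single_mem_nonneg c.2 (coe_constAlgFun c)

/-- The leading coefficient of a nonzero `x` is positive, and a nonnegative coefficient of `y`
cannot cancel it. -/
theorem nu_le_nu_add {x y : AlgFun} (hx : x ∈ nonnegAlgFun) (hy : y ∈ nonnegAlgFun) :
    nu x ≤ nu (x + y) := by
  by_cases hx0 : x = 0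
  · rw [hx0, nu_zero]
    exact bot_le
  obtain ⟨q, hq, hnu⟩ := exists_coeff_ne_zero_of_ne_zero hx0
  rw [hnu]
  refine le_nu_of_coeff_ne_zero fun h => hq ?_
  obtain ⟨r, hr, hr'⟩ := hx q
  obtain ⟨t, ht, ht'⟩ := hy q
  change (x : HahnSeries ℚ ℂ).coeff q + (y : HahnSeries ℚ ℂ).coeff q = 0 at h
  rw [hr', ht'] at h
  rw [hr']
  have h' : r + t = 0 := by exact_mod_cast h
  have : r = 0 := by linarith
  simp [this]

/-- There is no cancellation among series with nonnegative coefficients. -/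
theorem nu_sum {α : Type*} (s : Finset α) (x : α → AlgFun) (h : ∀ a ∈ s, x a ∈ nonnegAlgFun) :
    nu (∑ a ∈ s, x a) = s.sup fun a => nu (x a) := by
  classical
  induction s using Finset.induction_on with
  | empty => simp [nu_zero]
  | insert a s ha ih =>
    have h1 := h a (Finset.mem_insert_self a s)
    have h2 : ∀ c ∈ s, x c ∈ nonnegAlgFun := fun c hc => h c (Finset.mem_insert_of_mem hc)
    rw [Finset.sum_insert ha, Finset.sup_insert, ← ih h2]
    refine le_antisymm (nu_add_le _ _) (sup_le (nu_le_nu_add h1 (sum_mem h2)) ?_)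
    rw [add_comm]
    exact nu_le_nu_add (sum_mem h2) h1

/-- The absolute value on the field of algebraic functions. -/
noncomputable def algFunAbs : AbsoluteValue AlgFun ℝ where
  toFun x := (nu x).exp
  map_mul' x y := by rw [nu_mul, MaxPlus.exp_add, NNReal.coe_mul]
  nonneg' x := NNReal.coe_nonneg _
  eq_zero' x := by
    rw [NNReal.coe_eq_zero, ← MaxPlus.exp_bot, MaxPlus.exp_strictMono.injective.eq_iff, nu_eq_bot]
  add_le' x y := by
    refine le_trans (NNReal.coe_le_coe.2 (MaxPlus.exp_strictMono.monotone (nu_add_le x y))) ?_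
    rw [MaxPlus.exp_strictMono.monotone.map_max, ← NNReal.coe_add, NNReal.coe_le_coe]
    exact max_le le_self_add le_add_self

theorem algFunAbs_apply (x : AlgFun) : algFunAbs x = (nu x).exp := rfl

theorem isNonarchimedean_algFunAbs : IsNonarchimedean algFunAbs := by
  intro x y
  simp only [algFunAbs_apply]
  rw [← NNReal.coe_max, ← MaxPlus.exp_strictMono.monotone.map_max, NNReal.coe_le_coe]
  exact MaxPlus.exp_strictMono.monotone (nu_add_le x y)

end Valuation

/-! ### Gauss norms and roots in one variable -/

section Specialization

open Polynomial

theorem Polynomial.gaussNorm_X_sub_C {R : Type*} [CommRing R] [IsDomain R] (v : AbsoluteValue R ℝ)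
    {c : ℝ} (hc : 0 ≤ c) (r : R) :
    (X - C r).gaussNorm v c = max c (v r) := by
  refine le_antisymm ?_ (max_le ?_ ?_)
  · obtain ⟨i, hi⟩ := exists_eq_gaussNorm v c (X - C r)
    rw [hi]
    match i with
    | 0 => simp
    | 1 => simp
    | n + 2 =>
      have : (X - C r).coeff (n + 2) = 0 :=
        coeff_eq_zero_of_natDegree_lt (by rw [natDegree_X_sub_C]; omega)
      simp [this, hc]
  · have h := le_gaussNorm v (X - C r) hc 1
    rwa [coeff_sub, coeff_X_one, coeff_C_succ, sub_zero, map_one, one_mul, pow_one] at h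
  · have h := le_gaussNorm v (X - C r) hc 0
    rwa [coeff_sub, coeff_X_zero, coeff_C_zero, zero_sub, AbsoluteValue.map_neg, pow_zero,
      mul_one] at h

/-- Over the algebraically closed `AlgFun` the polynomial splits, and the Gauss norm of a
nonarchimedean absolute value is multiplicative. This is the Newton polygon in multiplicative form.
-/
theorem gaussNorm_eq_prod_roots {g : AlgFun[X]} {c : ℝ} (hc : 0 < c) :
    g.gaussNorm algFunAbs c =
      algFunAbs g.leadingCoeff * (g.roots.map fun r => max c (algFunAbs r)).prod := by
  have hprod : ∀ m : Multiset AlgFun, ((m.map fun r => X - C r).prod).gaussNorm algFunAbs c =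
      (m.map fun r => max c (algFunAbs r)).prod := by
    intro m
    induction m using Multiset.induction_on with
    | empty =>
      have := gaussNorm_C algFunAbs c (1 : AlgFun)
      simpa using this
    | cons a m ih =>
      rw [Multiset.map_cons, Multiset.prod_cons, gaussNorm_mul isNonarchimedean_algFunAbs hc, ih,
        gaussNorm_X_sub_C _ hc.le, Multiset.map_cons, Multiset.prod_cons]
  conv_lhs => rw [(IsAlgClosed.splits g).eq_prod_roots]
  rw [gaussNorm_mul isNonarchimedean_algFunAbs hc, gaussNorm_C, hprod]

variable {σ : Type*} [Fintype σ] [DecidableEq σ]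

/-- The polynomial in one variable obtained by specializing all variables but `i₀`. -/
noncomputable def specialize (f : MvPolynomial σ ℝ≥0) (y : σ → AlgFun) (i₀ : σ) : AlgFun[X] :=
  MvPolynomial.eval₂ (C.comp constAlgFun) (Function.update (fun v => C (y v)) i₀ X) f

omit [Fintype σ] in
theorem eval_specialize (f : MvPolynomial σ ℝ≥0) (y : σ → AlgFun) (i₀ : σ) (r : AlgFun) :
    (specialize f y i₀).eval r = MvPolynomial.eval₂ constAlgFun (Function.update y i₀ r) f := by
  have h := MvPolynomial.eval₂_comp_left (evalRingHom r) (C.comp constAlgFun)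
    (Function.update (fun v => C (y v)) i₀ X) f
  rw [specialize, ← coe_evalRingHom, h]
  congr 1
  · ext1 c
    simp
  · funext v
    by_cases hv : v = i₀
    · subst hv; simp
    · simp [hv]

/-- The coefficient of the monomial with exponent `s` in the specialization. -/
noncomputable def specializeCoeff (f : MvPolynomial σ ℝ≥0) (y : σ → AlgFun) (i₀ : σ)
    (s : σ →₀ ℕ) : AlgFun :=
  constAlgFun (f.coeff s) * ∏ v ∈ Finset.univ.erase i₀, y v ^ s v

theorem coeff_specialize (f : MvPolynomial σ ℝ≥0) (y : σ → AlgFun) (i₀ : σ) (j : ℕ) :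
    (specialize f y i₀).coeff j =
      ∑ s ∈ f.support with s i₀ = j, specializeCoeff f y i₀ s := by
  rw [specialize, MvPolynomial.eval₂_eq', finsetSum_coeff, Finset.sum_filter]
  refine Finset.sum_congr rfl fun s _ => ?_
  have h : (C.comp constAlgFun) (f.coeff s) *
      ∏ v, Function.update (fun v => C (y v)) i₀ X v ^ s v =
      C (specializeCoeff f y i₀ s) * X ^ s i₀ := by
    rw [← Finset.mul_prod_erase Finset.univ _ (Finset.mem_univ i₀), Function.update_self,
      specializeCoeff, map_mul, map_prod]
    have : ∏ v ∈ Finset.univ.erase i₀, Function.update (fun v => C (y v)) i₀ X v ^ s v =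
        ∏ v ∈ Finset.univ.erase i₀, C (y v ^ s v) :=
      Finset.prod_congr rfl fun v hv => by
        rw [Function.update_of_ne (Finset.ne_of_mem_erase hv), map_pow]
    rw [this, RingHom.comp_apply]
    ring
  rw [h, coeff_C_mul_X_pow]
  simp only [eq_comm]

theorem nu_specializeCoeff_add {f : MvPolynomial σ ℝ≥0} (y : σ → AlgFun) (i₀ : σ)
    {s : σ →₀ ℕ} (hs : s ∈ f.support) (p : MaxPlus) :
    nu (specializeCoeff f y i₀ s) + s i₀ • p =
      tropWeight (Function.update (fun v => nu (y v)) i₀ p) s := by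
  rw [specializeCoeff, nu_mul, nu_constAlgFun (MvPolynomial.mem_support_iff.1 hs), zero_add,
    nu_prod, tropWeight, ← Finset.sum_erase_add Finset.univ _ (Finset.mem_univ i₀),
    Function.update_self]
  congr 1
  refine Finset.sum_congr rfl fun v hv => ?_
  rw [Function.update_of_ne (Finset.ne_of_mem_erase hv), nu_pow]

theorem specializeCoeff_mem_nonneg (f : MvPolynomial σ ℝ≥0) {y : σ → AlgFun} {i₀ : σ}
    (hy : ∀ v, v ≠ i₀ → y v ∈ nonnegAlgFun) (s : σ →₀ ℕ) :
    specializeCoeff f y i₀ s ∈ nonnegAlgFun :=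
  mul_mem (constAlgFun_mem_nonnegAlgFun _)
    (prod_mem fun v hv => pow_mem (hy v (Finset.ne_of_mem_erase hv)) _)

/-- Several monomials of `f` may contribute to one coefficient of the specialization. With
nonnegative `y v` they do not cancel, so each coefficient has the maximal valuation of its
contributions. -/
theorem gaussNorm_specialize (f : MvPolynomial σ ℝ≥0) {y : σ → AlgFun} {i₀ : σ}
    (hy : ∀ v, v ≠ i₀ → y v ∈ nonnegAlgFun) (p : ℝ) :
    (specialize f y i₀).gaussNorm algFunAbs (Real.exp p) =
      (tropEval f (Function.update (fun v => nu (y v)) i₀ (p : MaxPlus))).exp := by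
  have hnu : ∀ j, nu ((specialize f y i₀).coeff j) =
      (f.support.filter fun s => s i₀ = j).sup fun s => nu (specializeCoeff f y i₀ s) := fun j => by
    rw [coeff_specialize, nu_sum _ _ fun s _ => specializeCoeff_mem_nonneg f hy s]
  have habs : ∀ (x : AlgFun) (j : ℕ), algFunAbs x * Real.exp p ^ j =
      (nu x + j • (p : MaxPlus)).exp := by
    intro x j
    rw [MaxPlus.exp_add, MaxPlus.exp_nsmul, algFunAbs_apply]
    push_cast
    rfl
  refine le_antisymm ?_ ?_
  · obtain ⟨j, hj⟩ := exists_eq_gaussNorm algFunAbs (Real.exp p) (specialize f y i₀)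
    rw [hj, habs, NNReal.coe_le_coe]
    refine MaxPlus.exp_strictMono.monotone ?_
    rw [hnu]
    rcases (f.support.filter fun s => s i₀ = j).eq_empty_or_nonempty with h | h
    · rw [h, Finset.sup_empty, WithBot.bot_add]
      exact bot_le
    · obtain ⟨s, hs, hs'⟩ := Finset.exists_mem_eq_sup _ h
        fun s => nu (specializeCoeff f y i₀ s)
      rw [Finset.mem_filter] at hs
      rw [hs', ← hs.2, nu_specializeCoeff_add y i₀ hs.1]
      exact tropWeight_le_tropEval hs.1 _
  · rcases f.support.eq_empty_or_nonempty with h | h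
    · rw [tropEval, h, Finset.sup_empty, MaxPlus.exp_bot]
      exact gaussNorm_nonneg _ _ (Real.exp_pos p).le
    · obtain ⟨s, hs, hs'⟩ := Finset.exists_mem_eq_sup _ h
        (tropWeight (Function.update (fun v => nu (y v)) i₀ (p : MaxPlus)))
      rw [tropEval, hs', ← nu_specializeCoeff_add y i₀ hs]
      refine le_trans ?_ (le_gaussNorm algFunAbs (specialize f y i₀) (Real.exp_pos p).le (s i₀))
      rw [habs, NNReal.coe_le_coe]
      refine MaxPlus.exp_strictMono.monotone ?_
      gcongr
      rw [hnu]
      exact Finset.le_sup (f := fun s => nu (specializeCoeff f y i₀ s)) (by simpa using hs)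

/-- The tropical polynomial function along one variable, in terms of the valuations of the
roots. -/
theorem tropEval_update_eq (f : MvPolynomial σ ℝ≥0) {y : σ → AlgFun} {i₀ : σ}
    (hy : ∀ v, v ≠ i₀ → y v ∈ nonnegAlgFun) (p : ℝ) :
    tropEval f (Function.update (fun v => nu (y v)) i₀ (p : MaxPlus)) =
      nu (specialize f y i₀).leadingCoeff +
        ((specialize f y i₀).roots.map fun r => max (p : MaxPlus) (nu r)).sum := by
  refine MaxPlus.exp_strictMono.injective (NNReal.coe_injective ?_)
  rw [← gaussNorm_specialize f hy, gaussNorm_eq_prod_roots (Real.exp_pos p), MaxPlus.exp_add,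
    MaxPlus.exp_multiset_sum, Multiset.map_map, NNReal.coe_mul, algFunAbs_apply]
  congr 1
  rw [← NNReal.coe_toRealHom, map_multiset_prod, Multiset.map_map]
  congr 1
  refine Multiset.map_congr rfl fun r _ => ?_
  simp only [Function.comp]
  rw [MaxPlus.exp_strictMono.monotone.map_max, NNReal.coe_toRealHom, NNReal.coe_max,
    MaxPlus.coe_exp_coe, algFunAbs_apply]

/-- Near `p` each summand is affine unless `ν r = p`, in which case it is `p + max t 0`. -/
theorem eventually_multiset_sum_max {α : Type*} (ν : α → MaxPlus) (m : Multiset α) (p : ℝ)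
    [DecidablePred fun r => ν r = (p : MaxPlus)] :
    ∃ c a : ℝ, ∀ᶠ t : ℝ in 𝓝 0, (m.map fun r => max ((p + t : ℝ) : MaxPlus) (ν r)).sum =
      ((c + a * t + ((m.filter fun r => ν r = p).card : ℝ) * max t 0 : ℝ) : MaxPlus) := by
  induction m using Multiset.induction_on with
  | empty => exact ⟨0, 0, by simp⟩
  | cons r m ih =>
    obtain ⟨c, a, h⟩ := ih
    have hstep : ∃ c' a' : ℝ, ∀ᶠ t : ℝ in 𝓝 0, max ((p + t : ℝ) : MaxPlus) (ν r) =
        ((c' + a' * t + (if ν r = p then 1 else 0) * max t 0 : ℝ) : MaxPlus) := by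
      rcases eq_or_ne (ν r) ⊥ with hr | hr
      · exact ⟨p, 1, by simp [hr]⟩
      · obtain ⟨x, hr⟩ := WithBot.ne_bot_iff_exists.1 hr
        have hcont : Tendsto (fun t : ℝ => p + t) (𝓝 0) (𝓝 p) := by
          have : Continuous fun t : ℝ => p + t := by fun_prop
          simpa using this.tendsto 0
        have hiff : ν r = (p : MaxPlus) ↔ x = p := by rw [← hr, WithBot.coe_inj]
        rcases lt_trichotomy p x with hx | rfl | hx
        · refine ⟨x, 0, ?_⟩
          filter_upwards [hcont.eventually_lt_const hx] with t ht
          rw [if_neg (hiff.not.2 hx.ne'), ← hr, max_eq_right (WithBot.coe_le_coe.2 ht.le)]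
          simp
        · refine ⟨p, 0, Eventually.of_forall fun t => ?_⟩
          rw [if_pos (hiff.2 rfl), ← hr, ← WithBot.coe_max]
          congr 1
          rw [zero_mul, add_zero, one_mul, ← max_add_add_left, add_zero]
        · refine ⟨p, 1, ?_⟩
          filter_upwards [hcont.eventually_const_lt hx] with t ht
          rw [if_neg (hiff.not.2 hx.ne), ← hr, max_eq_left (WithBot.coe_le_coe.2 ht.le)]
          simp
    obtain ⟨c', a', h'⟩ := hstep
    refine ⟨c' + c, a' + a, ?_⟩
    filter_upwards [h, h'] with t h1 h2
    rw [Multiset.map_cons, Multiset.sum_cons, h1, h2, ← WithBot.coe_add,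
      ← Multiset.countP_eq_card_filter, ← Multiset.countP_eq_card_filter, Multiset.countP_cons]
    congr 1
    split_ifs <;> push_cast <;> ring

theorem eventually_tropEval_update {f : MvPolynomial σ ℝ≥0} {y : σ → AlgFun} {i₀ : σ}
    (hy : ∀ v, v ≠ i₀ → y v ∈ nonnegAlgFun) {p : ℝ} (hg : specialize f y i₀ ≠ 0)
    [DecidablePred fun r => nu r = (p : MaxPlus)] :
    ∃ c a : ℝ, ∀ᶠ t : ℝ in 𝓝 0,
      tropEval f (Function.update (fun v => nu (y v)) i₀ ((p + t : ℝ) : MaxPlus)) =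
        ((c + a * t + (((specialize f y i₀).roots.filter fun r => nu r = p).card : ℝ) * max t 0 :
          ℝ) : MaxPlus) := by
  obtain ⟨c, a, h⟩ := eventually_multiset_sum_max nu (specialize f y i₀).roots p
  obtain ⟨l, hl⟩ := WithBot.ne_bot_iff_exists.1 (nu_eq_bot.not.2 (leadingCoeff_ne_zero.2 hg))
  refine ⟨l + c, a, ?_⟩
  filter_upwards [h] with t ht
  rw [tropEval_update_eq f hy, ← hl, ht, ← WithBot.coe_add]
  congr 1
  ring

/-- Without a root of valuation `p` the function would be affine near `p`, and its slope would equal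
both `s i₀` and `s' i₀`. -/
theorem exists_root_nu_eq {f : MvPolynomial σ ℝ≥0} {y : σ → AlgFun} {i₀ : σ}
    (hy : ∀ v, v ≠ i₀ → y v ∈ nonnegAlgFun) {p : ℝ} {s s' : σ →₀ ℕ}
    (hs : s ∈ f.support) (hs' : s' ∈ f.support) (hne : s i₀ ≠ s' i₀)
    (hT : tropEval f (Function.update (fun v => nu (y v)) i₀ (p : MaxPlus)) ≠ ⊥)
    (hsT : tropWeight (Function.update (fun v => nu (y v)) i₀ (p : MaxPlus)) s =
      tropEval f (Function.update (fun v => nu (y v)) i₀ (p : MaxPlus)))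
    (hsT' : tropWeight (Function.update (fun v => nu (y v)) i₀ (p : MaxPlus)) s' =
      tropEval f (Function.update (fun v => nu (y v)) i₀ (p : MaxPlus))) :
    ∃ r, (specialize f y i₀).eval r = 0 ∧ nu r = p := by
  classical
  have hg : specialize f y i₀ ≠ 0 := by
    intro hg
    rw [tropEval_update_eq f hy, hg, leadingCoeff_zero, nu_zero, WithBot.bot_add] at hT
    exact hT rfl
  by_contra! hcon
  obtain ⟨c, a, hca⟩ := eventually_tropEval_update hy (p := p) hg
  have hcard : ((specialize f y i₀).roots.filter fun r => nu r = p).card = 0 := by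
    rw [Multiset.card_eq_zero, Multiset.filter_eq_nil]
    intro r hr
    exact hcon r (mem_roots'.1 hr).2
  rw [hcard] at hca
  simp only [Nat.cast_zero, zero_mul, add_zero] at hca
  have h0 := hca.self_of_nhds
  simp only [add_zero, mul_zero] at h0
  have key : ∀ s ∈ f.support,
      tropWeight (Function.update (fun v => nu (y v)) i₀ (p : MaxPlus)) s =
        tropEval f (Function.update (fun v => nu (y v)) i₀ (p : MaxPlus)) → a = s i₀ := by
    intro s hs hsT
    have hd : HasDerivAt (fun t : ℝ => c + a * t) a 0 := by
      simpa using ((hasDerivAt_id (0 : ℝ)).const_mul a).const_add c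
    refine eq_of_hasDerivAt_of_forall_le hd ?_
    filter_upwards [hca] with t ht
    have h1 := tropWeight_le_tropEval hs
      (Function.update (fun v => nu (y v)) i₀ ((p + t : ℝ) : MaxPlus))
    rw [ht, ← nu_specializeCoeff_add y i₀ hs, WithBot.coe_add, nsmul_add, ← add_assoc,
      nu_specializeCoeff_add y i₀ hs, hsT, h0, MaxPlus.nsmul_coe, ← WithBot.coe_add,
      WithBot.coe_le_coe] at h1
    simpa using h1
  have := (key s hs hsT).symm.trans (key s' hs' hsT')
  exact hne (by exact_mod_cast this)

end Specialization

/-! ### Kapranov's theorem and the closure of the root valuations -/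

section RootValuations

variable {ι κ : Type*} [Fintype ι] [Fintype κ]

/-- The point with variables `x` and lifted parameters `z ^ (-A)`. -/
noncomputable def liftPoint (A : κ → ℚ) (x : ι → AlgFun) : ι ⊕ κ → AlgFun :=
  Sum.elim x fun j => zPow (-A j)

omit [Fintype ι] [Fintype κ] in
theorem nu_liftPoint (A : κ → ℚ) (x : ι → AlgFun) :
    (fun v => nu (liftPoint A x v)) = withParams A fun i => nu (x i) := by
  funext v
  rcases v with i | j
  · rfl
  · change nu (zPow (-A j)) = (((A j : ℚ) : ℝ) : MaxPlus)
    rw [nu_zPow, Rat.cast_neg, neg_neg]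

theorem nu_monomial {σ : Type*} [Fintype σ] {c : ℝ≥0} (hc : c ≠ 0) (y : σ → AlgFun)
    (s : σ →₀ ℕ) :
    nu (constAlgFun c * ∏ v, y v ^ s v) = tropWeight (fun v => nu (y v)) s := by
  rw [nu_mul, nu_constAlgFun hc, zero_add, nu_prod]
  simp_rw [nu_pow]
  rfl

theorem nu_eval₂_of_nonneg {σ : Type*} [Fintype σ] (f : MvPolynomial σ ℝ≥0) {y : σ → AlgFun}
    (hy : ∀ v, y v ∈ nonnegAlgFun) :
    nu (MvPolynomial.eval₂ constAlgFun y f) = tropEval f fun v => nu (y v) := by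
  rw [MvPolynomial.eval₂_eq', nu_sum, tropEval]
  · exact Finset.sup_congr rfl fun s hs => nu_monomial (MvPolynomial.mem_support_iff.1 hs) y s
  · exact fun s _ => mul_mem (constAlgFun_mem_nonnegAlgFun _)
      (prod_mem fun v _ => pow_mem (hy v) _)

omit [Fintype ι] in
theorem exists_nonneg_lift {P : ι → MaxPlus} (hP : P ∈ rationalPoints ι) :
    ∃ x : ι → AlgFun, (∀ i, x i ∈ nonnegAlgFun) ∧ ∀ i, nu (x i) = P i := by
  have h : ∀ i, ∃ x : AlgFun, x ∈ nonnegAlgFun ∧ nu x = P i := by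
    intro i
    rcases hP i with h | ⟨q, h⟩
    · exact ⟨0, zero_mem _, h ▸ nu_zero⟩
    · exact ⟨zPow (-q), zPow_mem_nonnegAlgFun _, by rw [h, nu_zPow, Rat.cast_neg, neg_neg]⟩
  choose x hx hx' using h
  exact ⟨x, hx, hx'⟩

/-- Otherwise all maximal monomials share the `ι`-exponents of one of them, `s`. The terms with
these exponents sum to valuation at least the maximum, the others to less, so the total cannot
vanish. -/
theorem rootValuations_subset {f : MvPolynomial (ι ⊕ κ) ℝ≥0} (hf : f ≠ 0) (A : κ → ℚ) :
    rootValuations f A ⊆ nonDiffLocus (fixParams (fun X => (tropEval f X).toEReal) A) := by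
  classical
  rintro _ ⟨x, hx, rfl⟩
  rw [mem_nonDiffLocus_iff hf]
  by_contra! hcon
  obtain ⟨hT, hact⟩ := hcon
  set Y := withParams A fun i => nu (x i) with hY
  obtain ⟨s, hs, hsT⟩ := exists_tropWeight_eq_tropEval hf Y
  set term : (ι ⊕ κ →₀ ℕ) → AlgFun := fun u =>
    constAlgFun (f.coeff u) * ∏ v, liftPoint A x v ^ u v with hterm
  have hnu : ∀ u ∈ f.support, nu (term u) = tropWeight Y u := fun u hu => by
    rw [hterm, nu_monomial (MvPolynomial.mem_support_iff.1 hu), nu_liftPoint]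
  have hsum : ∑ u ∈ f.support, term u = 0 := by
    rw [← MvPolynomial.eval₂_eq']
    exact hx
  rw [← Finset.sum_filter_add_sum_filter_not f.support
    fun u => ∀ i, u (Sum.inl i) = s (Sum.inl i)] at hsum
  have hrest : nu (∑ u ∈ f.support with ¬ ∀ i, u (Sum.inl i) = s (Sum.inl i), term u) <
      tropEval f Y := by
    refine nu_sum_lt hT fun u hu => ?_
    rw [Finset.mem_filter] at hu
    rw [hnu u hu.1]
    refine lt_of_le_of_ne (tropWeight_le_tropEval hu.1 Y) fun h => hu.2 fun i => ?_
    exact hact u hu.1 s hs i h hsT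
  -- These terms share the power of `x` given by `s`. The remaining factors have nonnegative
  -- coefficients, so their sum has at least the valuation of the one from `s`.
  have hmain : tropEval f Y ≤
      nu (∑ u ∈ f.support with ∀ i, u (Sum.inl i) = s (Sum.inl i), term u) := by
    have hfac : ∀ u, (∀ i, u (Sum.inl i) = s (Sum.inl i)) → term u =
        (∏ i, x i ^ s (Sum.inl i)) *
          (constAlgFun (f.coeff u) * ∏ j, zPow (-A j) ^ u (Sum.inr j)) := by
      intro u hu
      simp only [hterm, Fintype.prod_sum_type, liftPoint, Sum.elim_inl, Sum.elim_inr, hu]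
      ring
    have hs' : s ∈ f.support.filter fun u => ∀ i, u (Sum.inl i) = s (Sum.inl i) := by
      simpa using hs
    rw [Finset.sum_congr rfl fun u hu => hfac u (Finset.mem_filter.1 hu).2, ← Finset.mul_sum,
      nu_mul, nu_sum _ _ fun u _ => mul_mem (constAlgFun_mem_nonnegAlgFun _)
        (prod_mem fun j _ => pow_mem (zPow_mem_nonnegAlgFun _) _), ← hsT, ← hnu s hs,
      hfac s fun _ => rfl, nu_mul]
    gcongr
    exact Finset.le_sup (f := fun u => nu (constAlgFun (f.coeff u) *
      ∏ j, zPow (-A j) ^ u (Sum.inr j))) hs'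
  rw [eq_neg_of_add_eq_zero_left hsum, nu_neg] at hmain
  exact absurd hrest (not_lt.2 hmain)

/-- If the maximum is `-∞`, the nonnegative lift of `P` is itself a root. Otherwise one coordinate,
in which two maximal monomials differ, is replaced by a root of the specialized polynomial. -/
theorem mem_rootValuations_of_mem_nonDiffLocus {f : MvPolynomial (ι ⊕ κ) ℝ≥0} (hf : f ≠ 0)
    (A : κ → ℚ) {P : ι → MaxPlus} (hPr : P ∈ rationalPoints ι)
    (hP : P ∈ nonDiffLocus (fixParams (fun X => (tropEval f X).toEReal) A)) :
    P ∈ rootValuations f A := by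
  classical
  obtain ⟨x, hx, hxP⟩ := exists_nonneg_lift hPr
  have hy : ∀ v, liftPoint A x v ∈ nonnegAlgFun := by
    rintro (i | j)
    · exact hx i
    · exact zPow_mem_nonnegAlgFun _
  have hY : (fun v => nu (liftPoint A x v)) = withParams A P := by
    rw [nu_liftPoint]
    simp_rw [hxP]
  rcases eq_or_ne (tropEval f (withParams A P)) ⊥ with hT | hT
  · refine ⟨x, nu_eq_bot.1 ?_, funext fun i => (hxP i).symm⟩
    rw [← hT, ← hY]
    exact nu_eval₂_of_nonneg f hy
  obtain hP | ⟨s, hs, s', hs', i, hsT, hsT', hne⟩ := (mem_nonDiffLocus_iff hf A P).1 hP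
  · exact absurd hP hT
  -- A monomial of finite weight does not involve a variable at `-∞`, whereas `s` and `s'` differ at
  -- `i`.
  have hPi : P i ≠ ⊥ := by
    intro h
    have h0 : ∀ u, tropWeight (withParams A P) u = tropEval f (withParams A P) →
        u (Sum.inl i) = 0 := by
      intro u hu
      by_contra hu0
      exact hT (hu ▸ tropWeight_eq_bot (Y := withParams A P) (v := Sum.inl i) h hu0)
    exact hne ((h0 s hsT).trans (h0 s' hsT').symm)
  obtain ⟨p, hp⟩ := WithBot.ne_bot_iff_exists.1 hPi
  have hupd : Function.update (fun v => nu (liftPoint A x v)) (Sum.inl i) (p : MaxPlus) =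
      withParams A P := by
    rw [hY, hp]
    exact Function.update_eq_self (Sum.inl i) (withParams A P)
  obtain ⟨r, hr, hrp⟩ := exists_root_nu_eq (i₀ := Sum.inl i) (p := p) (fun v _ => hy v) hs hs' hne
    (hupd ▸ hT) (hupd ▸ hsT) (hupd ▸ hsT')
  refine ⟨Function.update x i r, ?_, ?_⟩
  · rw [eval_specialize, liftPoint, Sum.update_elim_inl] at hr
    exact hr
  · funext j
    rcases eq_or_ne j i with rfl | hj
    · rw [Function.update_self, hrp, hp]
    · rw [Function.update_of_ne hj, hxP]

/-- **Kapranov's theorem** for lifts of subtraction-free polynomials. -/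
theorem rootValuations_eq {f : MvPolynomial (ι ⊕ κ) ℝ≥0} (hf : f ≠ 0) (A : κ → ℚ) :
    rootValuations f A =
      nonDiffLocus (fixParams (fun X => (tropEval f X).toEReal) A) ∩ rationalPoints ι := by
  refine Set.Subset.antisymm (fun P hP => ⟨rootValuations_subset hf A hP, ?_⟩)
    fun P hP => mem_rootValuations_of_mem_nonDiffLocus hf A hP.2 hP.1
  obtain ⟨x, -, rfl⟩ := hP
  exact nu_mem_rationalPoints x

theorem closure_rootValuations {f : MvPolynomial (ι ⊕ κ) ℝ≥0} (hf : f ≠ 0) (A : κ → ℚ) :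
    closure (rootValuations f A) =
      nonDiffLocus (fixParams (fun X => (tropEval f X).toEReal) A) := by
  rw [rootValuations_eq hf]
  exact Set.Subset.antisymm
    (closure_minimal Set.inter_subset_left (isClosed_nonDiffLocus hf A))
    (nonDiffLocus_subset_closure hf A)

omit [Fintype ι] [Fintype κ] in
theorem withParams_coe (A : κ → ℚ) (p : ι → ℝ) :
    (withParams A fun i => (p i : MaxPlus)) =
      fun v => ((Sum.elim p (fun j => (A j : ℝ)) v : ℝ) : MaxPlus) := by
  funext v
  rcases v with i | j <;> rfl

theorem tropEval_withParams_coe_ne_bot {f : MvPolynomial (ι ⊕ κ) ℝ≥0} (hf : f ≠ 0) (A : κ → ℚ)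
    (p : ι → ℝ) : tropEval f (withParams A fun i => (p i : MaxPlus)) ≠ ⊥ := by
  obtain ⟨s, -, hsT⟩ := exists_tropWeight_eq_tropEval hf (withParams A fun i => (p i : MaxPlus))
  rw [← hsT, withParams_coe, tropWeight_coe]
  exact WithBot.coe_ne_bot

/-- In one variable a tie is a nontrivial linear equation for `p` with rational coefficients. -/
theorem nonDiffLocus_subset_rationalPoints [Unique ι] {f : MvPolynomial (ι ⊕ κ) ℝ≥0} (hf : f ≠ 0)
    (A : κ → ℚ) :
    nonDiffLocus (fixParams (fun X => (tropEval f X).toEReal) A) ⊆ rationalPoints ι := by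
  intro P hP i
  rw [Unique.eq_default i]
  rcases eq_or_ne (P default) ⊥ with h | h
  · exact Or.inl h
  obtain ⟨p, hp⟩ := WithBot.ne_bot_iff_exists.1 h
  have hPp : P = fun _ => (p : MaxPlus) := funext fun i => by rw [Unique.eq_default i, hp]
  subst hPp
  rw [mem_nonDiffLocus_iff hf] at hP
  obtain hP | ⟨s, hs, s', hs', i, hsT, hsT', hne⟩ := hP
  · exact absurd hP (tropEval_withParams_coe_ne_bot hf A fun _ => p)
  rw [← hsT', withParams_coe A fun _ => p, tropWeight_coe, tropWeight_coe, WithBot.coe_inj] at hsT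
  simp only [Fintype.sum_sum_type, Sum.elim_inl, Sum.elim_inr, Fintype.sum_unique] at hsT
  rw [Unique.eq_default i] at hne
  refine Or.inr ⟨(∑ j, s' (Sum.inr j) * A j - ∑ j, s (Sum.inr j) * A j) /
    (s (Sum.inl default) - s' (Sum.inl default)), WithBot.coe_inj.2 ?_⟩
  push_cast
  have h0 : (s (Sum.inl default) : ℝ) - s' (Sum.inl default) ≠ 0 :=
    sub_ne_zero.2 (by exact_mod_cast hne)
  rw [eq_div_iff h0]
  linarith

end RootValuations

/-! ### Differences of tropical polynomials and root counts -/

section Difference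

variable {ι κ : Type*} [Fintype ι] [Fintype κ]

theorem TropDifferentiableAt.sub {G₀ G₁ : (ι → MaxPlus) → EReal} {P : ι → MaxPlus}
    (h₀ : TropDifferentiableAt G₀ P) (h₁ : TropDifferentiableAt G₁ P) :
    TropDifferentiableAt (fun X => G₀ X - G₁ X) P := by
  rw [tropDifferentiableAt_iff] at *
  obtain ⟨g₀, hg₀, h₀⟩ := h₀
  obtain ⟨g₁, hg₁, h₁⟩ := h₁
  refine ⟨fun v => g₀ v - g₁ v, hg₀.sub hg₁, ?_⟩
  filter_upwards [h₀, h₁] with v h₀ h₁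
  rw [h₀, h₁, EReal.coe_sub]

/-- When `G₁` and `G₀ - G₁` are real, `G₀` cannot be infinite, so it is recovered by adding `G₁`. -/
theorem TropDifferentiableAt.of_sub_left {G₀ G₁ : (ι → MaxPlus) → EReal} {P : ι → MaxPlus}
    (h : TropDifferentiableAt (fun X => G₀ X - G₁ X) P) (h₁ : TropDifferentiableAt G₁ P) :
    TropDifferentiableAt G₀ P := by
  rw [tropDifferentiableAt_iff] at *
  obtain ⟨g, hg, h⟩ := h
  obtain ⟨g₁, hg₁, h₁⟩ := h₁
  refine ⟨fun v => g v + g₁ v, hg.add hg₁, ?_⟩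
  filter_upwards [h, h₁] with v h h₁
  rw [h₁] at h
  generalize G₀ (fun i => P i + (v i : MaxPlus)) = a at h ⊢
  induction a with
  | bot => simp at h
  | top => simp at h
  | coe a =>
    norm_cast at h ⊢
    linarith

theorem TropDifferentiableAt.of_sub_right {G₀ G₁ : (ι → MaxPlus) → EReal} {P : ι → MaxPlus}
    (h : TropDifferentiableAt (fun X => G₀ X - G₁ X) P) (h₀ : TropDifferentiableAt G₀ P) :
    TropDifferentiableAt G₁ P := by
  rw [tropDifferentiableAt_iff] at *
  obtain ⟨g, hg, h⟩ := h
  obtain ⟨g₀, hg₀, h₀⟩ := h₀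
  refine ⟨fun v => g₀ v - g v, hg₀.sub hg, ?_⟩
  filter_upwards [h, h₀] with v h h₀
  rw [h₀] at h
  generalize G₁ (fun i => P i + (v i : MaxPlus)) = a at h ⊢
  induction a with
  | bot => simp at h
  | top => simp at h
  | coe a =>
    norm_cast at h ⊢
    linarith

theorem nonDiffLocus_sub_subset (G₀ G₁ : (ι → MaxPlus) → EReal) :
    nonDiffLocus (fun X => G₀ X - G₁ X) ⊆ nonDiffLocus G₀ ∪ nonDiffLocus G₁ := by
  intro P hP
  by_contra hcon
  rw [Set.mem_union, not_or] at hcon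
  exact hP ((not_not.1 hcon.1).sub (not_not.1 hcon.2))

theorem mem_nonDiffLocus_sub {G₀ G₁ : (ι → MaxPlus) → EReal} {P : ι → MaxPlus}
    (hP : P ∈ nonDiffLocus G₀ ∪ nonDiffLocus G₁) (hP' : P ∉ nonDiffLocus G₀ ∩ nonDiffLocus G₁) :
    P ∈ nonDiffLocus fun X => G₀ X - G₁ X := by
  intro h
  rcases hP with h₀ | h₁
  · exact hP' ⟨h₀, fun h₁ => h₀ (h.of_sub_left h₁)⟩
  · exact hP' ⟨fun h₀ => h₁ (h.of_sub_right h₀), h₁⟩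

theorem not_differentiableAt_mul_max {k : ℝ} (hk : k ≠ 0) :
    ¬ DifferentiableAt ℝ (fun t : ℝ => k * max t 0) 0 := by
  intro h
  refine not_differentiableAt_abs_zero ?_
  have h2 : (abs : ℝ → ℝ) = fun t => 2 * (k⁻¹ * (k * max t 0)) - t := by
    funext t
    rw [inv_mul_cancel_left₀ hk]
    rcases le_total t 0 with ht | ht
    · rw [abs_of_nonpos ht, max_eq_right ht]; ring
    · rw [abs_of_nonneg ht, max_eq_left ht]; ring
  rw [h2]
  exact ((h.const_mul _).const_mul _).sub differentiableAt_id

theorem eventually_tropEval_eq_rootCount [Unique ι] {f : MvPolynomial (ι ⊕ κ) ℝ≥0} (hf : f ≠ 0)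
    (A : κ → ℚ) (p : ℝ) :
    ∃ c a : ℝ, ∀ᶠ t : ℝ in 𝓝 0, tropEval f (withParams A fun _ : ι => ((p + t : ℝ) : MaxPlus)) =
      ((c + a * t + (rootCount f A (p : MaxPlus) : ℝ) * max t 0 : ℝ) : MaxPlus) := by
  classical
  -- The value `0` is arbitrary: the only variable is replaced by `X` in the specialization.
  set y : ι ⊕ κ → AlgFun := liftPoint A fun _ => 0 with hy
  have hupd : ∀ x : MaxPlus, Function.update (fun v => nu (y v)) (Sum.inl default) x =
      withParams A fun _ : ι => x := by
    intro x
    rw [hy, nu_liftPoint, withParams, Sum.update_elim_inl, Function.update_eq_const_of_subsingleton]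
    rfl
  have hpoly : specialize f y (Sum.inl default) = liftPoly f A := by
    rw [specialize, liftPoly]
    congr 1
    funext v
    rcases v with i | j
    · rw [Unique.eq_default i, Function.update_self]; rfl
    · rw [Function.update_of_ne (by simp)]; rfl
  have hy' : ∀ v, v ≠ Sum.inl (default : ι) → y v ∈ nonnegAlgFun := by
    rintro (i | j) -
    · exact zero_mem _
    · exact zPow_mem_nonnegAlgFun _
  have hg : specialize f y (Sum.inl default) ≠ 0 := by
    intro hg
    have h := tropEval_update_eq f hy' p
    rw [hg, Polynomial.leadingCoeff_zero, nu_zero, WithBot.bot_add, hupd] at h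
    exact tropEval_withParams_coe_ne_bot hf A (fun _ => p) h
  obtain ⟨c, a, h⟩ := eventually_tropEval_update hy' (p := p) hg
  refine ⟨c, a, ?_⟩
  filter_upwards [h] with t ht
  rw [hupd, hpoly] at ht
  rw [ht, rootCount]

/-- Near `p` the difference is an affine function plus `(k₀ - k₁) * max t 0`, which has a corner
unless `k₀ = k₁`. -/
theorem mem_nonDiffLocus_sub_iff_rootCount_ne [Unique ι] {f₀ f₁ : MvPolynomial (ι ⊕ κ) ℝ≥0}
    (hf₀ : f₀ ≠ 0) (hf₁ : f₁ ≠ 0) (A : κ → ℚ) (p : ℝ) :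
    (fun _ => (p : MaxPlus)) ∈ nonDiffLocus (ι := ι)
        (fixParams (fun X => (tropEval f₀ X).toEReal - (tropEval f₁ X).toEReal) A) ↔
      rootCount f₀ A (p : MaxPlus) ≠ rootCount f₁ A (p : MaxPlus) := by
  obtain ⟨c₀, a₀, h₀⟩ := eventually_tropEval_eq_rootCount hf₀ A p
  obtain ⟨c₁, a₁, h₁⟩ := eventually_tropEval_eq_rootCount hf₁ A p
  set k₀ := rootCount f₀ A (p : MaxPlus)
  set k₁ := rootCount f₁ A (p : MaxPlus)
  have hpt : ∀ v : ι → ℝ, (fun i => (p : MaxPlus) + (v i : MaxPlus)) =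
      fun _ => ((p + v default : ℝ) : MaxPlus) := fun v => funext fun i => by
    rw [Unique.eq_default i, WithBot.coe_add]
  have hG : ∀ᶠ t : ℝ in 𝓝 0, ∀ v : ι → ℝ, v default = t →
      fixParams (fun X => (tropEval f₀ X).toEReal - (tropEval f₁ X).toEReal) A
        (fun i => (p : MaxPlus) + (v i : MaxPlus)) =
      (((c₀ - c₁) + (a₀ - a₁) * t + ((k₀ : ℝ) - k₁) * max t 0 : ℝ) : EReal) := by
    filter_upwards [h₀, h₁] with t ht₀ ht₁ v hv
    rw [hpt, hv]
    change (tropEval f₀ (withParams A fun _ => _)).toEReal -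
      (tropEval f₁ (withParams A fun _ => _)).toEReal = _
    rw [ht₀, ht₁, MaxPlus.toEReal_coe, MaxPlus.toEReal_coe, ← EReal.coe_sub]
    congr 1
    ring
  rw [nonDiffLocus, Set.mem_ofPred_eq, not_iff_not, tropDifferentiableAt_iff]
  constructor
  · rintro ⟨h, hd, hev⟩
    by_contra hne
    have hk : (k₀ : ℝ) - k₁ ≠ 0 := sub_ne_zero.2 (by exact_mod_cast hne)
    refine not_differentiableAt_mul_max hk ?_
    have hconst : Continuous fun t : ℝ => (fun _ : ι => t) := by fun_prop
    have htend : Tendsto (fun t : ℝ => (fun _ : ι => t)) (𝓝 0) (𝓝 0) := hconst.tendsto 0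
    have hcomp : DifferentiableAt ℝ (fun t : ℝ => h fun _ => t) 0 :=
      DifferentiableAt.comp (g := h) (f := fun t : ℝ => (fun _ : ι => t)) 0 hd (by fun_prop)
    have hdiff : DifferentiableAt ℝ
        (fun t : ℝ => (h fun _ => t) - ((c₀ - c₁) + (a₀ - a₁) * t)) 0 :=
      hcomp.sub (by fun_prop)
    refine hdiff.congr_of_eventuallyEq ?_
    filter_upwards [hG, htend.eventually hev] with t h1 h2
    rw [h1 _ rfl, EReal.coe_eq_coe_iff] at h2
    linarith
  · intro hk
    refine ⟨fun v => (c₀ - c₁) + (a₀ - a₁) * v default, by fun_prop, ?_⟩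
    have htend : Tendsto (fun v : ι → ℝ => v default) (𝓝 0) (𝓝 0) :=
      (continuous_apply default).tendsto 0
    filter_upwards [htend.eventually hG] with v hv
    rw [hv v rfl, hk]
    simp

end Difference

/-! ### The main theorem -/

theorem mainTheorem2 {ι κ : Type*} [Fintype ι] [Fintype κ]
    (f₀ f₁ : MvPolynomial (ι ⊕ κ) ℝ≥0) (hf₀ : f₀ ≠ 0) (hf₁ : f₁ ≠ 0) :
    ∃ F₀ F₁ F : (ι ⊕ κ → MaxPlus) → EReal,
      IsUltradiscretization (sfEval f₀) F₀ ∧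
      IsUltradiscretization (sfEval f₁) F₁ ∧
      IsUltradiscretization (fun x => sfEval f₀ x / sfEval f₁ x) F ∧
      (∀ X, F X = F₀ X - F₁ X) ∧
      ∀ A : κ → ℚ,
        -- valuations of the roots are the points of non-differentiability
        rootValuations f₀ A = nonDiffLocus (fixParams F₀ A) ∩ rationalPoints ι ∧
        rootValuations f₁ A = nonDiffLocus (fixParams F₁ A) ∩ rationalPoints ι ∧
        closure (rootValuations f₀ A) = nonDiffLocus (fixParams F₀ A) ∧
        closure (rootValuations f₁ A) = nonDiffLocus (fixParams F₁ A) ∧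
        (∀ _ : Unique ι,
          rootValuations f₀ A = nonDiffLocus (fixParams F₀ A) ∧
          rootValuations f₁ A = nonDiffLocus (fixParams F₁ A)) ∧
        -- the locus of `F` is the union of those of `F₀` and `F₁`, up to cancellation
        nonDiffLocus (fixParams F A) ⊆
          nonDiffLocus (fixParams F₀ A) ∪ nonDiffLocus (fixParams F₁ A) ∧
        (∀ P ∈ nonDiffLocus (fixParams F₀ A) ∪ nonDiffLocus (fixParams F₁ A),
          P ∉ nonDiffLocus (fixParams F₀ A) ∩ nonDiffLocus (fixParams F₁ A) →
            P ∈ nonDiffLocus (fixParams F A)) ∧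
        (Disjoint (nonDiffLocus (fixParams F₀ A)) (nonDiffLocus (fixParams F₁ A)) →
          nonDiffLocus (fixParams F A) =
            nonDiffLocus (fixParams F₀ A) ∪ nonDiffLocus (fixParams F₁ A)) ∧
        (∀ _ : Unique ι, ∀ p : ℝ,
          (fun _ => (p : MaxPlus)) ∈ nonDiffLocus (fixParams F A) ↔
            rootCount f₀ A (p : MaxPlus) ≠ rootCount f₁ A (p : MaxPlus)) := by
  refine ⟨fun X => (tropEval f₀ X).toEReal, fun X => (tropEval f₁ X).toEReal,
    fun X => (tropEval f₀ X).toEReal - (tropEval f₁ X).toEReal,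
    isUltradiscretization_sfEval hf₀, isUltradiscretization_sfEval hf₁,
    isUltradiscretization_sfEval_div hf₀ hf₁, fun _ => rfl, fun A => ?_⟩
  have hV : ∀ _ : Unique ι, ∀ f : MvPolynomial (ι ⊕ κ) ℝ≥0, f ≠ 0 → rootValuations f A =
      nonDiffLocus (fixParams (fun X => (tropEval f X).toEReal) A) := fun _ f hf =>
    (rootValuations_eq hf A).trans
      (Set.inter_eq_left.2 (nonDiffLocus_subset_rationalPoints hf A))
  refine ⟨rootValuations_eq hf₀ A, rootValuations_eq hf₁ A, closure_rootValuations hf₀ A,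
    closure_rootValuations hf₁ A, fun h => ⟨hV h f₀ hf₀, hV h f₁ hf₁⟩,
    nonDiffLocus_sub_subset _ _, fun P hP hP' => mem_nonDiffLocus_sub hP hP', fun hdisj => ?_,
    fun _ p => mem_nonDiffLocus_sub_iff_rootCount_ne hf₀ hf₁ A p⟩
  refine Set.Subset.antisymm (nonDiffLocus_sub_subset _ _) fun P hP =>
    mem_nonDiffLocus_sub hP fun h => ?_
  exact Set.disjoint_left.1 hdisj h.1 h.2
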